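/- All graphs are finite and simple. For a graph $G$, let $\Delta(G)$ be its maximum degree, and let $\chi_l(G)$ be its list chromatic number, i.e. the least $k$ such that for every assignment of a list $L(v)\subset\mathbb{N}$ with $|L(v)|=k$ to each vertex $v$ there is a proper coloring $c$ of $G$ with $c(v)\in L(v)$ for all $v$. A graph is claw-free if it has no induced subgraph isomorphic to $K_{1,3}$, and quasi-line if the neighborhood of every vertex can be covered by two cliques. Theorem. Suppose that every quasi-line graph $H$ with $\chi_l(H)\ge\Delta(H)\ge 9$ contains a clique on $\Delta(H)$ vertices. Then every claw-free graph $G$ with $\chi_l(G)\ge\Delta(G)\ge 9$ contains a clique on $\Delta(G)$ vertices. -/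

import Mathlib

universe u

namespace SimpleGraph

variable {V : Type*}

/-- A list assignment `L` is good if `G` has a proper coloring `c` with `c v ∈ L v` for all `v`. -/
def IsGoodListAssignment (G : SimpleGraph V) (L : V → Finset ℕ) : Prop :=
  ∃ c : G.Coloring ℕ, ∀ v, c v ∈ L v

/-- `G` is `f`-choosable if every list assignment with `|L v| = f v` for all `v` is good. -/
def FChoosable (G : SimpleGraph V) (f : V → ℕ) : Prop :=
  ∀ L : V → Finset ℕ, (∀ v, (L v).card = f v) → G.IsGoodListAssignment L

/-- `G` is `k`-choosable if it is `f`-choosable for the constant function `f = k`. -/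
def Choosable (G : SimpleGraph V) (k : ℕ) : Prop :=
  G.FChoosable fun _ => k

/-- The list chromatic number `χ_l`: the least `k` such that `G` is `k`-choosable
(`⊤` if there is none, which does not happen for finite graphs). -/
noncomputable def listChromaticNumber (G : SimpleGraph V) : ℕ∞ :=
  ⨅ k ∈ {k : ℕ | G.Choosable k}, (k : ℕ∞)

/-- A graph is claw-free if it has no induced `K_{1,3}`. -/
def IsClawFree (G : SimpleGraph V) : Prop :=
  ¬ (completeBipartiteGraph (Fin 1) (Fin 3)).IsIndContained G

/-- A vertex is bisimplicial if its neighborhood can be covered by two cliques. -/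
def IsBisimplicial (G : SimpleGraph V) (v : V) : Prop :=
  ∃ A B : Set V, G.IsClique A ∧ G.IsClique B ∧ G.neighborSet v ⊆ A ∪ B

/-- A graph is quasi-line if every vertex is bisimplicial. -/
def IsQuasiLine (G : SimpleGraph V) : Prop :=
  ∀ v, G.IsBisimplicial v

end SimpleGraph

namespace SimpleGraph

/-! ### Coded graphs and a verified search for induced subgraphs. -/

section InducedCopies

variable {W : Type*}

/-- `IsCopy H p l` says that the vertices `l` are distinct and induce in `H` the graph coded by `p`:
each entry of `p` lists the adjacencies of a vertex of `l` to the later ones. -/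
def IsCopy (H : SimpleGraph W) : List (List Bool) → List W → Prop
  | [], [] => True
  | c :: p, x :: l => List.Forall₂ (fun b y => x ≠ y ∧ (H.Adj x y ↔ b = true)) c l ∧ IsCopy H p l
  | _, _ => False

/-- The lowest `n` binary digits of `m`, the highest first. -/
def binaryDigits (m : ℕ) : ℕ → List Bool
  | 0 => []
  | n + 1 => m.testBit n :: binaryDigits m n

/-- The code of a graph whose adjacencies to later vertices are given as binary numbers. -/
def decode : List ℕ → List (List Bool)
  | [] => []
  | m :: r => binaryDigits m r.length :: decode r

theorem IsCopy.length_eq {H : SimpleGraph W} {p : List (List Bool)} {l : List W}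
    (h : IsCopy H p l) : p.length = l.length := by
  induction p generalizing l with
  | nil => cases l <;> simp_all [IsCopy]
  | cons c p ih =>
    cases l with
    | nil => simp [IsCopy] at h
    | cons x l => simpa using ih h.2

theorem IsCopy.nodup {H : SimpleGraph W} {p : List (List Bool)} {l : List W}
    (h : IsCopy H p l) : l.Nodup := by
  induction p generalizing l with
  | nil => cases l <;> simp_all [IsCopy]
  | cons c p ih =>
    cases l with
    | nil => simp
    | cons x l =>
      refine List.nodup_cons.2 ⟨fun hx => ?_, ih h.2⟩
      have key : ∀ {c : List Bool} {l : List W},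
          List.Forall₂ (fun b y => x ≠ y ∧ (H.Adj x y ↔ b = true)) c l → x ∉ l := by
        intro c l hl
        induction hl with
        | nil => simp
        | cons hb _ ih => simp [hb.1, ih]
      exact key h.1 hx

/-- All ways to complete the partially prescribed list of digits. -/
def completions : List (Option Bool) → List (List Bool)
  | [] => [[]]
  | some b :: s => (completions s).map (b :: ·)
  | none :: s => (completions s).map (false :: ·) ++ (completions s).map (true :: ·)

theorem IsCopy.exists_cons {H : SimpleGraph W} {p : List (List Bool)} {l : List W}
    (h : IsCopy H p l) {x : W} (hx : x ∉ l) {s : List (Option Bool)}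
    (hs : List.Forall₂ (fun o y => ∀ b ∈ o, (H.Adj x y ↔ b = true)) s l) :
    ∃ c ∈ completions s, IsCopy H (c :: p) (x :: l) := by
  suffices H : ∃ c ∈ completions s,
      List.Forall₂ (fun b y => x ≠ y ∧ (H.Adj x y ↔ b = true)) c l by
    obtain ⟨c, hc, hl⟩ := H
    exact ⟨c, hc, hl, h⟩
  clear h
  induction hs with
  | nil => exact ⟨[], by simp [completions], .nil⟩
  | @cons o y s l ho _ ih =>
    simp only [List.mem_cons, not_or] at hx
    obtain ⟨c, hc, hl⟩ := ih hx.2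
    rcases o with _ | b
    · by_cases hy : H.Adj x y
      · exact ⟨true :: c, by simp [completions, hc], .cons ⟨hx.1, by simpa using hy⟩ hl⟩
      · exact ⟨false :: c, by simp [completions, hc], .cons ⟨hx.1, by simpa using hy⟩ hl⟩
    · exact ⟨b :: c, by simp [completions, hc], .cons ⟨hx.1, ho b rfl⟩ hl⟩

/-- The set of positions, counted from the end, at which `true` occurs in the list, as a bit mask. -/
def bitMask : List Bool → ℕ
  | [] => 0
  | b :: c => bif b then Nat.lor (2 ^ c.length) (bitMask c) else bitMask c

/-- For each vertex of a coded graph: its bit, the mask of its neighbors, and the mask of its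
non-neighbors other than itself. -/
def maskTable : List (List Bool) → List (ℕ × ℕ × ℕ)
  | [] => []
  | c :: p => (2 ^ p.length, bitMask c, bitMask (c.map not)) ::
      List.zipWith (fun b e => bif b then (e.1, Nat.lor e.2.1 (2 ^ p.length), e.2.2)
        else (e.1, e.2.1, Nat.lor e.2.2 (2 ^ p.length))) c (maskTable p)

/-- Intersect each mask in the list with `nb` or `co`, as the digits say, and pass the result on
unless one of the masks becomes empty. It is written with recursors to evaluate fast. -/
noncomputable def narrowMasks (nb co : ℕ) (c : List Bool) :
    List ℕ → (List ℕ → Bool) → Bool :=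
  List.rec (motive := fun _ => List ℕ → (List ℕ → Bool) → Bool)
    (fun ds k => List.rec (motive := fun _ => Bool) (k []) (fun _ _ _ => false) ds)
    (fun b _ ih ds k => List.rec (motive := fun _ => Bool) false
      (fun d ds _ => Bool.rec
        (ih ds fun l => k (Nat.land d (Bool.rec co nb b) :: l)) false
        (Nat.beq (Nat.land d (Bool.rec co nb b)) 0)) ds) c

/-- Backtracking search for an induced copy of `p` in the graph with the given mask table, where
the masks `ds` give the admissible places for each vertex of `p`. -/
noncomputable def searchCopy (t : List (ℕ × ℕ × ℕ)) (p : List (List Bool)) : List ℕ → Bool :=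
  List.rec (motive := fun _ => List ℕ → Bool)
    (fun ds => List.rec (motive := fun _ => Bool) true (fun _ _ _ => false) ds)
    (fun c _ ih ds => List.rec (motive := fun _ => Bool) false
      (fun d ds _ => List.rec (motive := fun _ => Bool) false
        -- `Bool.rec` takes its value at `false` first: an inadmissible place or a failed branch
        -- moves on to the next entry of the table.
        (fun e _ rest => Bool.rec rest true
          (Bool.rec (narrowMasks e.2.1 e.2.2 c ds ih) false (Nat.beq (Nat.land d e.1) 0))) t) ds) p

/-- Initial masks for a search: everywhere the mask `m`, but `m'` at position `q`. -/
def initialMasks (m m' : ℕ) (k q : ℕ) : List ℕ :=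
  (List.replicate k m).set q m'

/-- `MaskTableFor H f n t` says that the table `t` describes adjacencies in `H` correctly if bit `i`
stands for the vertex `f i`, for `i < n`. -/
def MaskTableFor (H : SimpleGraph W) (f : ℕ → W) (n : ℕ) (t : List (ℕ × ℕ × ℕ)) : Prop :=
  ∀ e ∈ t, ∃ i < n, e.1 = 2 ^ i ∧ ∀ j < n, (e.2.1.testBit j = true → H.Adj (f i) (f j)) ∧
    (e.2.2.testBit j = true → f i ≠ f j ∧ ¬ H.Adj (f i) (f j))

/-- `MaskEntryFor H f n e y` says that the entry `e` of a mask table describes the vertex `y`. -/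
def MaskEntryFor (H : SimpleGraph W) (f : ℕ → W) (n : ℕ) (e : ℕ × ℕ × ℕ) (y : W) : Prop :=
  ∃ i < n, y = f i ∧ e.1 = 2 ^ i ∧ ∀ j, (e.2.1.testBit j = true → j < n ∧ H.Adj y (f j)) ∧
    (e.2.2.testBit j = true → j < n ∧ y ≠ f j ∧ ¬ H.Adj y (f j))

theorem land_two_pow_ne_zero {d i : ℕ} (h : Nat.beq (Nat.land d (2 ^ i)) 0 = false) :
    d.testBit i = true := by
  by_contra hd
  have : d &&& 2 ^ i = 0 := by
    rw [Nat.and_two_pow, Bool.eq_false_iff.2 hd]; simp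
  rw [show Nat.land d (2 ^ i) = 0 from this] at h
  simp at h

theorem narrowMasks_eq_true {nb co : ℕ} {c : List Bool} {ds : List ℕ} {k : List ℕ → Bool}
    (h : narrowMasks nb co c ds k = true) : c.length = ds.length ∧
      k (List.zipWith (fun b d => Nat.land d (if b then nb else co)) c ds) = true := by
  induction c generalizing ds k with
  | nil =>
    cases ds with
    | nil => exact ⟨rfl, h⟩
    | cons d ds => simp [narrowMasks] at h
  | cons b c ih =>
    cases ds with
    | nil => simp [narrowMasks] at h
    | cons d ds =>
      let m : ℕ := Bool.rec co nb b
      have hb : m = if b then nb else co := by cases b <;> rfl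
      cases hz : Nat.beq (Nat.land d m) 0 with
      | true =>
        have : narrowMasks nb co (b :: c) (d :: ds) k = false := by
          change (Bool.rec _ false (Nat.beq (Nat.land d m) 0) : Bool) = false
          rw [hz]
        simp [this] at h
      | false =>
        have : narrowMasks nb co (b :: c) (d :: ds) k =
            narrowMasks nb co c ds fun l => k (Nat.land d m :: l) := by
          change (Bool.rec (narrowMasks nb co c ds fun l => k (Nat.land d m :: l)) false
            (Nat.beq (Nat.land d m) 0) : Bool) = _
          rw [hz]
        rw [this] at h
        obtain ⟨hl, hk⟩ := ih h
        exact ⟨by simp [hl], by simpa [hb] using hk⟩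

theorem searchCopy_cons_eq_true {t : List (ℕ × ℕ × ℕ)} {c : List Bool} {p : List (List Bool)}
    {ds : List ℕ} (h : searchCopy t (c :: p) ds = true) :
    ∃ d ds', ds = d :: ds' ∧ ∃ e ∈ t, Nat.beq (Nat.land d e.1) 0 = false ∧
      narrowMasks e.2.1 e.2.2 c ds' (searchCopy t p) = true := by
  cases ds with
  | nil => simp [searchCopy] at h
  | cons d ds =>
    refine ⟨d, ds, rfl, ?_⟩
    change List.rec (motive := fun _ => Bool) false
        (fun e _ rest => Bool.rec rest true
          (Bool.rec (narrowMasks e.2.1 e.2.2 c ds (searchCopy t p)) false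
            (Nat.beq (Nat.land d e.1) 0))) t = true at h
    generalize searchCopy t p = k at h ⊢
    induction t with
    | nil => simp at h
    | cons e t ih =>
      cases hz : Nat.beq (Nat.land d e.1) 0 with
      | true =>
        simp only [hz] at h
        obtain ⟨e', he', h'⟩ := ih h
        exact ⟨e', by simp [he'], h'⟩
      | false =>
        simp only [hz] at h
        cases hn : narrowMasks e.2.1 e.2.2 c ds k with
        | true => exact ⟨e, by simp, hz, hn⟩
        | false =>
          simp only [hn] at h
          obtain ⟨e', he', h'⟩ := ih h
          exact ⟨e', by simp [he'], h'⟩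

theorem forall₂_of_forall₂_zipWith {α β γ δ : Type*} {P : γ → δ → Prop} {g : α → β → γ}
    {c : List α} {ds : List β} {l : List δ} (hlen : c.length = ds.length)
    (h : List.Forall₂ P (List.zipWith g c ds) l) {Q : α → δ → Prop} {R : β → δ → Prop}
    (hQ : ∀ a b y, P (g a b) y → Q a y) (hR : ∀ a b y, P (g a b) y → R b y) :
    List.Forall₂ Q c l ∧ List.Forall₂ R ds l := by
  induction c generalizing ds l with
  | nil =>
    cases ds <;> simp_all
  | cons a c ih =>
    cases ds with
    | nil => simp at hlen
    | cons b ds =>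
      simp only [List.zipWith_cons_cons] at h
      cases h with
      | cons hy h =>
        obtain ⟨h1, h2⟩ := ih (by simpa using hlen) h
        exact ⟨.cons (hQ _ _ _ hy) h1, .cons (hR _ _ _ hy) h2⟩

/-- Only soundness of the search is needed, so the initial masks are arbitrary. The second conjunct
carries the induction: a later vertex lies in a mask already intersected with the neighbors or
non-neighbors of the current vertex, which gives the required adjacency. -/
theorem exists_isCopy_of_searchCopy {H : SimpleGraph W} {f : ℕ → W} {n : ℕ}
    {t : List (ℕ × ℕ × ℕ)} (ht : MaskTableFor H f n t) {p : List (List Bool)} {ds : List ℕ}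
    (h : searchCopy t p ds = true) :
    ∃ l, IsCopy H p l ∧
      List.Forall₂ (fun (d : ℕ) y => ∃ i < n, d.testBit i = true ∧ y = f i) ds l := by
  induction p generalizing ds with
  | nil =>
    cases ds with
    | nil => exact ⟨[], trivial, .nil⟩
    | cons d ds => simp [searchCopy] at h
  | cons c p ih =>
    obtain ⟨d, ds, rfl, e, he, hd, hn⟩ := searchCopy_cons_eq_true h
    obtain ⟨hlen, hk⟩ := narrowMasks_eq_true hn
    obtain ⟨l, hl, hf⟩ := ih hk
    obtain ⟨i, hi, hei, hadj⟩ := ht e he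
    rw [hei] at hd
    have hand (a b j : ℕ) (h : (Nat.land a b).testBit j = true) :
        a.testBit j = true ∧ b.testBit j = true := by
      have : (a &&& b).testBit j = true := h
      simpa using this
    obtain ⟨h1, h2⟩ := forall₂_of_forall₂_zipWith (hlen := hlen) hf
      (Q := fun b y => f i ≠ y ∧ (H.Adj (f i) y ↔ b = true))
      (R := fun (d : ℕ) y => ∃ i < n, d.testBit i = true ∧ y = f i)
      (by
        rintro b d y ⟨j, hj, hb, rfl⟩
        have := (hand _ _ _ hb).2
        cases b with
        | true =>
          have := (hadj j hj).1 (by simpa using this)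
          exact ⟨this.ne, by simpa using this⟩
        | false => simpa using (hadj j hj).2 (by simpa using this))
      (by
        rintro b d y ⟨j, hj, hb, rfl⟩
        exact ⟨j, hj, (hand _ _ _ hb).1, rfl⟩)
    exact ⟨f i :: l, ⟨h1, hl⟩, .cons ⟨i, hi, land_two_pow_ne_zero hd, rfl⟩ h2⟩

theorem testBit_lor_two_pow {m k j : ℕ} (h : (Nat.lor m (2 ^ k)).testBit j = true) :
    m.testBit j = true ∨ j = k := by
  have : (m ||| 2 ^ k).testBit j = true := h
  rw [Nat.testBit_or, Nat.testBit_two_pow, Bool.or_eq_true, decide_eq_true_eq] at this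
  exact this.imp_right Eq.symm

theorem of_testBit_bitMask {R : Bool → W → Prop} {c : List Bool} {l : List W} {f : ℕ → W}
    (h : List.Forall₂ R c l) (hf : l.reverse = (List.range l.length).map f) {j : ℕ}
    (hj : (bitMask c).testBit j = true) : j < l.length ∧ R true (f j) := by
  induction h with
  | nil => simp [bitMask] at hj
  | @cons b y c l hb hl ih =>
    simp only [List.reverse_cons, List.length_cons, List.range_succ, List.map_append,
      List.map_cons, List.map_nil] at hf
    obtain ⟨hf1, hf2⟩ := List.append_inj' hf rfl
    simp only [List.cons.injEq, and_true] at hf2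
    have hlen : c.length = l.length := hl.length_eq
    have key : (bitMask c).testBit j = true → j < (y :: l).length ∧ R true (f j) := fun h =>
      (ih hf1 h).imp (fun h => by simp only [List.length_cons]; omega) id
    cases b with
    | false => exact key hj
    | true =>
      have h' : (2 ^ c.length ||| bitMask c).testBit j = true := hj
      simp only [Nat.testBit_or, Nat.testBit_two_pow, Bool.or_eq_true, decide_eq_true_eq] at h'
      rcases h' with rfl | h'
      · simp [hlen, ← hf2, hb]
      · exact key h'

/-- A vertex added in front gets the new highest bit `n`. The old masks survive the change from `f`
to `g` because `MaskEntryFor` allows no bits at `n` or above. -/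
theorem forall₂_maskEntryFor_zipWith {H : SimpleGraph W} {f g : ℕ → W} {n : ℕ} {x : W}
    (hgf : ∀ i < n, g i = f i) (hgx : g n = x) {t : List (ℕ × ℕ × ℕ)} {l : List W}
    {c : List Bool} (ht : List.Forall₂ (MaskEntryFor H f n) t l)
    (hc : List.Forall₂ (fun b y => x ≠ y ∧ (H.Adj x y ↔ b = true)) c l) :
    List.Forall₂ (MaskEntryFor H g (n + 1)) (List.zipWith
      (fun b e => bif b then (e.1, Nat.lor e.2.1 (2 ^ n), e.2.2)
        else (e.1, e.2.1, Nat.lor e.2.2 (2 ^ n))) c t) l := by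
  induction ht generalizing c with
  | nil => cases hc; exact .nil
  | @cons e y t l he _ ih =>
    cases hc with
    | @cons b _ c _ hb hc =>
      refine .cons ?_ (ih hc)
      obtain ⟨i, hi, hy, hei, hadj⟩ := he
      have old (j : ℕ) : (e.2.1.testBit j = true → j < n + 1 ∧ H.Adj y (g j)) ∧
          (e.2.2.testBit j = true → j < n + 1 ∧ y ≠ g j ∧ ¬ H.Adj y (g j)) := by
        refine ⟨fun hj => ?_, fun hj => ?_⟩
        · obtain ⟨h1, h2⟩ := (hadj j).1 hj
          exact ⟨by omega, by rwa [hgf j h1]⟩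
        · obtain ⟨h1, h2⟩ := (hadj j).2 hj
          exact ⟨by omega, by rwa [hgf j h1]⟩
      cases b with
      | true =>
        refine ⟨i, by omega, by rw [hgf i hi, hy], hei, fun j => ⟨fun hj => ?_, (old j).2⟩⟩
        rcases testBit_lor_two_pow hj with hj | rfl
        · exact (old j).1 hj
        · exact ⟨by simp, hgx ▸ (by simpa [adj_comm] using hb.2)⟩
      | false =>
        refine ⟨i, by omega, by rw [hgf i hi, hy], hei, fun j => ⟨(old j).1, fun hj => ?_⟩⟩
        rcases testBit_lor_two_pow hj with hj | rfl
        · exact (old j).2 hj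
        · exact ⟨by simp, hgx ▸ hb.1.symm, hgx ▸ (by simpa [adj_comm] using hb.2)⟩

theorem exists_maskTable_forall₂ [Nonempty W] {H : SimpleGraph W} {p : List (List Bool)}
    {l : List W} (h : IsCopy H p l) :
    ∃ f : ℕ → W, l.reverse = (List.range l.length).map f ∧
      List.Forall₂ (MaskEntryFor H f l.length) (maskTable p) l := by
  induction p generalizing l with
  | nil =>
    cases l with
    | nil => exact ⟨fun _ => Classical.arbitrary W, rfl, .nil⟩
    | cons x l => exact h.elim
  | cons c p ih =>
    cases l with
    | nil => exact h.elim
    | cons x l =>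
      obtain ⟨f, hf, ht⟩ := ih h.2
      have hlen := h.2.length_eq
      let g := Function.update f l.length x
      have hgx : g l.length = x := by simp [g]
      have hgf (i : ℕ) (hi : i < l.length) : g i = f i := by simp [g, hi.ne]
      have hg : l.reverse = (List.range l.length).map g := by
        rw [hf]
        exact List.map_congr_left fun i hi => (hgf i (List.mem_range.1 hi)).symm
      refine ⟨g, ?_, .cons ?_ ?_⟩
      · simp [List.range_succ, hg, hgx]
      · refine ⟨l.length, by simp, hgx.symm, by simp [hlen], fun j => ⟨fun hj => ?_, fun hj => ?_⟩⟩
        · obtain ⟨h1, h2⟩ := of_testBit_bitMask h.1 hg hj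
          exact ⟨by simp; omega, by simpa using h2.2⟩
        · obtain ⟨h1, h2⟩ := of_testBit_bitMask
            (R := fun b y => x ≠ y ∧ (H.Adj x y ↔ (!b) = true))
            (List.forall₂_map_left_iff.2 (h.1.imp fun b y hb => by simpa using hb)) hg hj
          exact ⟨by simp; omega, by simpa using h2⟩
      · rw [hlen]
        exact forall₂_maskEntryFor_zipWith hgf hgx ht h.1

theorem IsCopy.exists_maskTableFor [Nonempty W] {H : SimpleGraph W} {p : List (List Bool)}
    {l : List W} (h : IsCopy H p l) :
    ∃ (f : ℕ → W) (n : ℕ), MaskTableFor H f n (maskTable p) := by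
  obtain ⟨f, -, ht⟩ := exists_maskTable_forall₂ h
  refine ⟨f, l.length, fun e he => ?_⟩
  have key : ∀ {t : List (ℕ × ℕ × ℕ)} {l' : List W},
      List.Forall₂ (MaskEntryFor H f l.length) t l' → e ∈ t → ∃ y, MaskEntryFor H f l.length e y := by
    intro t l' ht he
    induction ht with
    | nil => simp at he
    | cons hy _ ih =>
      rcases List.mem_cons.1 he with rfl | he
      exacts [⟨_, hy⟩, ih he]
  obtain ⟨_, i, hi, rfl, hei, hadj⟩ := key ht he
  exact ⟨i, hi, hei, fun j _ => ⟨fun h => ((hadj j).1 h).2, fun h => ((hadj j).2 h).2⟩⟩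

/-- Whether the graph coded by `r` has an induced subgraph coded by `p` in which the first vertex
of `r` has position `q`; no position is prescribed if `q` is not less than the length of `p`. -/
noncomputable def hasCopyAt (r p : List (List Bool)) (q : ℕ) : Bool :=
  searchCopy (maskTable r) p (initialMasks (2 ^ r.length - 1) (2 ^ (r.length - 1)) p.length q)

theorem IsCopy.exists_of_hasCopyAt [Nonempty W] {H : SimpleGraph W} {r p : List (List Bool)}
    {l : List W} (h : IsCopy H r l) {q : ℕ} (hq : hasCopyAt r p q = true) :
    ∃ l', IsCopy H p l' := by
  obtain ⟨f, n, ht⟩ := h.exists_maskTableFor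
  exact (exists_isCopy_of_searchCopy ht hq).imp fun _ h => h.1

/-- Whether each extension of the graph coded by `r` by a vertex, with adjacencies prescribed in part
by `s`, has an induced subgraph that occurs in `hints` or `targets`; the hints come with the
position of the new vertex. -/
noncomputable def coversExtensions (r : List (List Bool)) (s : List (Option Bool))
    (hints : List (List (List Bool) × ℕ)) (targets : List (List (List Bool))) : Bool :=
  (completions s).all fun c => hints.any (fun h => hasCopyAt (c :: r) h.1 h.2) ||
    targets.any fun p => hasCopyAt (c :: r) p p.length

theorem IsCopy.exists_of_coversExtensions [Nonempty W] {H : SimpleGraph W}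
    {r : List (List Bool)} {l : List W} (h : IsCopy H r l) {s : List (Option Bool)}
    {hints : List (List (List Bool) × ℕ)} {targets : List (List (List Bool))}
    (hc : coversExtensions r s hints targets = true) {x : W} (hx : x ∉ l)
    (hs : List.Forall₂ (fun o y => ∀ b ∈ o, (H.Adj x y ↔ b = true)) s l) :
    (∃ e ∈ hints, ∃ l', IsCopy H e.1 l') ∨ ∃ p ∈ targets, ∃ l', IsCopy H p l' := by
  obtain ⟨c, hcs, hcopy⟩ := h.exists_cons hx hs
  have := List.all_eq_true.1 hc c hcs
  rw [Bool.or_eq_true, List.any_eq_true, List.any_eq_true] at this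
  exact this.imp (fun ⟨e, he, h'⟩ => ⟨e, he, hcopy.exists_of_hasCopyAt h'⟩)
    fun ⟨p, hp, h'⟩ => ⟨p, hp, hcopy.exists_of_hasCopyAt h'⟩

end InducedCopies

/-! ### The Alon–Tarsi theorem, with orientation counts as coefficients of the graph polynomial. -/

section AlonTarsi

open MvPolynomial

variable {W : Type*}

/-- The signed sum, over all orientations of the edges between a vertex and later vertices that give
this vertex outdegree `t`, of `k` at the outdegrees that remain to be given to the later vertices,
if these have to get the outdegrees in the list. -/
def starOrientationSum : List Bool → List ℕ → ℕ → (List ℕ → ℤ) → ℤ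
  | [], [], t, k => bif Nat.beq t 0 then k [] else 0
  | false :: c, s :: ts, t, k => starOrientationSum c ts t fun l => k (s :: l)
  | true :: c, s :: ts, t, k =>
    (bif Nat.beq t 0 then 0 else starOrientationSum c ts (Nat.sub t 1) fun l => k (s :: l)) -
      (bif Nat.beq s 0 then 0 else starOrientationSum c ts t fun l => k (Nat.sub s 1 :: l))
  | _, _, _, _ => 0

/-- The number of even minus the number of odd orientations of the coded graph that have the given
outdegrees. -/
def orientationSum : List (List Bool) → List ℕ → ℤ
  | [], [] => 1
  | c :: p, t :: ts => starOrientationSum c ts t (orientationSum p)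
  | _, _ => 0

/-- The product of `X x - X y` over those `y` in the list that are marked by `true`. -/
noncomputable def starPolynomial (x : W) : List Bool → List W → MvPolynomial W ℤ
  | true :: c, y :: l => (X x - X y) * starPolynomial x c l
  | false :: c, _ :: l => starPolynomial x c l
  | _, _ => 1

/-- The graph polynomial of the coded graph on the vertices of the list. -/
noncomputable def copyPolynomial : List (List Bool) → List W → MvPolynomial W ℤ
  | c :: p, x :: l => starPolynomial x c l * copyPolynomial p l
  | _, _ => 1

/-- The exponent vector with the given values on the vertices of the list. -/
noncomputable def exponents : List W → List ℕ → W →₀ ℕ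
  | x :: l, t :: ts => Finsupp.single x t + exponents l ts
  | _, _ => 0

theorem exponents_apply_of_notMem {x : W} {l : List W} (hx : x ∉ l) (ts : List ℕ) :
    exponents l ts x = 0 := by
  induction l generalizing ts with
  | nil => simp [exponents]
  | cons y l ih =>
    simp only [List.mem_cons, not_or] at hx
    cases ts with
    | nil => simp [exponents]
    | cons t ts => simp [exponents, ih hx.2, Ne.symm hx.1]

theorem degreeOf_starPolynomial {x z : W} (hx : z ≠ x) (c : List Bool) {l : List W} (hz : z ∉ l) :
    degreeOf z (starPolynomial x c l) = 0 := by
  induction l generalizing c with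
  | nil => cases c <;> simp [starPolynomial]
  | cons y l ih =>
    simp only [List.mem_cons, not_or] at hz
    rcases c with _ | ⟨_ | _, c⟩
    · simp [starPolynomial]
    · simpa [starPolynomial] using ih c hz.2
    · refine Nat.le_zero.1 ((degreeOf_mul_le _ _ _).trans ?_)
      rw [ih c hz.2]
      refine (degreeOf_sub_le _ _ _).trans ?_
      classical
      simp [degreeOf_X, hx, hz.1]

theorem degreeOf_copyPolynomial {z : W} (p : List (List Bool)) {l : List W} (hz : z ∉ l) :
    degreeOf z (copyPolynomial p l) = 0 := by
  induction l generalizing p with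
  | nil => cases p <;> simp [copyPolynomial]
  | cons x l ih =>
    simp only [List.mem_cons, not_or] at hz
    cases p with
    | nil => simp [copyPolynomial]
    | cons c p =>
      refine Nat.le_zero.1 ((degreeOf_mul_le _ _ _).trans ?_)
      rw [ih p hz.2, degreeOf_starPolynomial hz.1 c hz.2]

theorem coeff_eq_zero_of_degreeOf_eq_zero {Q : MvPolynomial W ℤ} {x : W} (hQ : degreeOf x Q = 0)
    {m : W →₀ ℕ} (hm : m x ≠ 0) : coeff m Q = 0 := by
  by_contra h
  have := monomial_le_degreeOf x (mem_support_iff.2 h)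
  omega

theorem coeff_X_mul_eq_zero {Q : MvPolynomial W ℤ} {x : W} {m : W →₀ ℕ} (hm : m x = 0) :
    coeff m (X x * Q) = 0 := by
  classical
  rw [coeff_X_mul', if_neg (by simpa using hm)]

/-- Expand the factors `X x - X y` one at a time: the term `X x` orients the edge out of `x` and
lowers `t`, the term `-X y` lowers the outdegree of `y`. Once `y` is passed, what is left of its
outdegree moves into `m`, to be supplied by `Q`. At the end `t` must be `0`, as `x` does not occur
in `Q`. -/
theorem starOrientationSum_eq_coeff {x : W} {Q : MvPolynomial W ℤ} (hQ : degreeOf x Q = 0)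
    {c : List Bool} {l : List W} {ts : List ℕ} (hc : c.length = l.length)
    (ht : ts.length = l.length) (hl : (x :: l).Nodup) {m : W →₀ ℕ} (hm : ∀ y ∈ x :: l, m y = 0)
    {k : List ℕ → ℤ} (hk : ∀ ts', ts'.length = l.length → k ts' = coeff (m + exponents l ts') Q)
    (t : ℕ) : starOrientationSum c ts t k =
      coeff (m + Finsupp.single x t + exponents l ts) (starPolynomial x c l * Q) := by
  induction l generalizing c ts m k t with
  | nil =>
    cases List.length_eq_zero_iff.1 hc
    cases List.length_eq_zero_iff.1 ht
    cases t with
    | zero => simpa [starOrientationSum, starPolynomial] using hk [] rfl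
    | succ t =>
      simp only [starOrientationSum, starPolynomial, one_mul, exponents, add_zero]
      rw [coeff_eq_zero_of_degreeOf_eq_zero hQ (by simp)]
      rfl
  | cons y l ih =>
    rcases c with _ | ⟨b, c⟩
    · simp at hc
    rcases ts with _ | ⟨s, ts⟩
    · simp at ht
    simp only [List.length_cons, Nat.add_right_cancel_iff] at hc ht
    simp only [List.nodup_cons, List.mem_cons, not_or] at hl
    obtain ⟨⟨hxy, hxl⟩, hyl, hl⟩ := hl
    have hmx : m x = 0 := hm x (by simp)
    have hmy : m y = 0 := hm y (by simp)
    have step (s' t' : ℕ) : starOrientationSum c ts t' (fun l => k (s' :: l)) =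
        coeff (m + Finsupp.single x t' + exponents (y :: l) (s' :: ts))
          (starPolynomial x c l * Q) := by
      rw [ih (m := m + Finsupp.single y s') hc ht (by simp [hxl, hl])]
      · congr 1
        simp only [exponents]
        abel
      · intro z hz
        have hzy : y ≠ z := by
          rintro rfl
          rcases List.mem_cons.1 hz with rfl | hz
          exacts [hxy rfl, hyl hz]
        have : m z = 0 := by
          rcases List.mem_cons.1 hz with rfl | hz
          exacts [hmx, hm z (by simp [hz])]
        simp [this, hzy]
      · intro ts' hts'
        rw [hk _ (by simp [hts'])]
        simp only [exponents, add_assoc]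
    cases b with
    | false => exact step s t
    | true =>
      simp only [starOrientationSum, starPolynomial]
      rw [sub_mul, sub_mul, coeff_sub, mul_assoc, mul_assoc]
      congr 1
      · cases t with
        | zero =>
          rw [coeff_X_mul_eq_zero (by
            simp [hmx, exponents, Ne.symm hxy,
              exponents_apply_of_notMem hxl])]
          rfl
        | succ t =>
          rw [show m + Finsupp.single x (t + 1) + exponents (y :: l) (s :: ts) =
            Finsupp.single x 1 + (m + Finsupp.single x t + exponents (y :: l) (s :: ts)) by
              rw [Finsupp.single_add]; abel, coeff_X_mul]
          exact step s t
      · cases s with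
        | zero =>
          rw [coeff_X_mul_eq_zero (by
            simp [hmy, exponents, hxy,
              exponents_apply_of_notMem hyl])]
          rfl
        | succ s =>
          rw [show m + Finsupp.single x t + exponents (y :: l) ((s + 1) :: ts) =
            Finsupp.single y 1 + (m + Finsupp.single x t + exponents (y :: l) (s :: ts)) by
              simp only [exponents]; rw [Finsupp.single_add]; abel, coeff_X_mul]
          exact step s t

theorem IsCopy.orientationSum_eq_coeff {H : SimpleGraph W} {p : List (List Bool)} {l : List W}
    (h : IsCopy H p l) {ts : List ℕ} (ht : ts.length = l.length) :
    orientationSum p ts = coeff (exponents l ts) (copyPolynomial p l) := by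
  induction p generalizing l ts with
  | nil =>
    cases l with
    | nil => cases List.length_eq_zero_iff.1 ht; simp [orientationSum, exponents, copyPolynomial]
    | cons x l => exact h.elim
  | cons c p ih =>
    cases l with
    | nil => exact h.elim
    | cons x l =>
      rcases ts with _ | ⟨t, ts⟩
      · simp at ht
      have hnd := h.nodup
      have hxl : x ∉ l := (List.nodup_cons.1 hnd).1
      rw [orientationSum, starOrientationSum_eq_coeff (m := 0) (degreeOf_copyPolynomial p hxl)
        h.1.length_eq (by simpa using ht) hnd (by simp)
        (fun ts' hts' => by rw [ih h.2 hts', zero_add])]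
      simp [exponents, copyPolynomial]

theorem isHomogeneous_starPolynomial (x : W) (c : List Bool) (l : List W) :
    ∃ n, (starPolynomial x c l).IsHomogeneous n := by
  induction l generalizing c with
  | nil => exact ⟨0, by cases c <;> simpa [starPolynomial] using isHomogeneous_one W ℤ⟩
  | cons y l ih =>
    rcases c with _ | ⟨_ | _, c⟩
    · exact ⟨0, isHomogeneous_one W ℤ⟩
    · exact ih c
    · obtain ⟨n, hn⟩ := ih c
      exact ⟨1 + n, ((isHomogeneous_X ℤ x).sub (isHomogeneous_X ℤ y)).mul hn⟩

theorem isHomogeneous_copyPolynomial (p : List (List Bool)) (l : List W) :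
    ∃ n, (copyPolynomial p l).IsHomogeneous n := by
  induction l generalizing p with
  | nil => exact ⟨0, by cases p <;> simpa [copyPolynomial] using isHomogeneous_one W ℤ⟩
  | cons x l ih =>
    cases p with
    | nil => exact ⟨0, isHomogeneous_one W ℤ⟩
    | cons c p =>
      obtain ⟨n, hn⟩ := ih p
      obtain ⟨m, hm⟩ := isHomogeneous_starPolynomial x c l
      exact ⟨m + n, hm.mul hn⟩

theorem ne_of_eval_starPolynomial_ne_zero {H : SimpleGraph W} {x : W} {c : List Bool} {l : List W}
    (h : List.Forall₂ (fun b y => x ≠ y ∧ (H.Adj x y ↔ b = true)) c l) {s : W → ℤ}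
    (hs : eval s (starPolynomial x c l) ≠ 0) {y : W} (hy : y ∈ l) (hxy : H.Adj x y) :
    s x ≠ s y := by
  induction h with
  | nil => simp at hy
  | @cons b z c l hb _ ih =>
    cases b with
    | false =>
      rcases List.mem_cons.1 hy with rfl | hy
      · simp [hxy] at hb
      · exact ih hs hy
    | true =>
      simp only [starPolynomial, map_mul, map_sub, eval_X, mul_ne_zero_iff, sub_ne_zero] at hs
      rcases List.mem_cons.1 hy with rfl | hy
      · exact hs.1
      · exact ih hs.2 hy

theorem IsCopy.ne_of_eval_copyPolynomial_ne_zero {H : SimpleGraph W} {p : List (List Bool)}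
    {l : List W} (h : IsCopy H p l) {s : W → ℤ} (hs : eval s (copyPolynomial p l) ≠ 0) {y z : W}
    (hy : y ∈ l) (hz : z ∈ l) (hyz : H.Adj y z) : s y ≠ s z := by
  induction p generalizing l with
  | nil => cases l <;> simp_all [IsCopy]
  | cons c p ih =>
    cases l with
    | nil => simp at hy
    | cons x l =>
      simp only [copyPolynomial, map_mul, mul_ne_zero_iff] at hs
      rcases List.mem_cons.1 hy with rfl | hy' <;> rcases List.mem_cons.1 hz with rfl | hz'
      · exact (hyz.ne rfl).elim
      · exact ne_of_eval_starPolynomial_ne_zero h.1 hs.1 hz' hyz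
      · exact (ne_of_eval_starPolynomial_ne_zero h.1 hs.1 hy' hyz.symm).symm
      · exact ih h.2 hs.2 hy' hz'

theorem forall₂_exponents {ts : List ℕ} {l : List W} {P : ℕ → W → Prop} (hl : l.Nodup)
    (h : List.Forall₂ P ts l) {y : W} (hy : y ∈ l) : P (exponents l ts y) y := by
  induction h with
  | nil => simp at hy
  | @cons t x ts l ht _ ih =>
    obtain ⟨hx, hl⟩ := List.nodup_cons.1 hl
    rcases List.mem_cons.1 hy with rfl | hy
    · simpa [exponents, exponents_apply_of_notMem hx] using ht
    · have : x ≠ y := by rintro rfl; exact hx hy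
      simpa [exponents, Finsupp.single_apply, this] using ih hl hy

/-- The **Alon–Tarsi theorem** for an induced subgraph: if the orientations with given outdegrees
have a nonzero signed count, then the subgraph can be colored from all lists that are longer than
the outdegrees. -/
theorem IsCopy.exists_coloring [Finite W] {H : SimpleGraph W} {p : List (List Bool)} {l : List W}
    (h : IsCopy H p l) {ts : List ℕ} (hts : orientationSum p ts ≠ 0) {S : W → Finset ℕ}
    (hS : List.Forall₂ (fun t y => t < (S y).card) ts l) :
    ∃ g : W → ℕ, (∀ y ∈ l, g y ∈ S y) ∧ ∀ y ∈ l, ∀ z ∈ l, H.Adj y z → g y ≠ g z := by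
  classical
  rw [h.orientationSum_eq_coeff hS.length_eq] at hts
  obtain ⟨n, hn⟩ := isHomogeneous_copyPolynomial p l
  -- By homogeneity every monomial with nonzero coefficient has top degree, as the Combinatorial
  -- Nullstellensatz requires.
  have hdeg : (copyPolynomial p l).totalDegree = (exponents l ts).degree := by
    rw [hn.totalDegree (by rintro h0; simp [h0] at hts)]
    by_contra hne
    exact hts (hn.coeff_eq_zero (Ne.symm hne))
  obtain ⟨s, hs, hev⟩ := combinatorial_nullstellensatz_exists_eval_nonzero _ _ hts hdeg
    -- Off `l` the exponent is `0`, so a single value suffices there.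
    (fun y => if y ∈ l then (S y).map Nat.castEmbedding else {0}) (fun y => by
      by_cases hy : y ∈ l
      · simpa [hy] using forall₂_exponents h.nodup hS hy
      · simp [hy, exponents_apply_of_notMem hy])
  have hmem (y : W) (hy : y ∈ l) : ∃ a ∈ S y, (a : ℤ) = s y := by
    simpa [hy] using hs y
  refine ⟨fun y => (s y).toNat, fun y hy => ?_, fun y hy z hz hyz heq => ?_⟩
  · obtain ⟨a, ha, hay⟩ := hmem y hy
    simpa [← hay] using ha
  · obtain ⟨a, ha, hay⟩ := hmem y hy
    obtain ⟨b, hb, hbz⟩ := hmem z hz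
    refine h.ne_of_eval_copyPolynomial_ne_zero hev hy hz hyz ?_
    simp only [← hay, ← hbz, Int.toNat_natCast] at heq ⊢
    rw [heq]

end AlonTarsi

/-! ### Graphs that are critical for a list assignment. -/

section Critical

variable {W : Type*}

/-- The degrees of a coded graph. -/
def codeDegrees : List (List Bool) → List ℕ
  | [] => []
  | c :: p => c.count true :: List.zipWith (fun b d => bif b then d + 1 else d) c (codeDegrees p)

theorem IsCopy.forall₂_codeDegrees {H : SimpleGraph W} [DecidableRel H.Adj]
    {p : List (List Bool)} {l : List W} (h : IsCopy H p l) :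
    List.Forall₂ (fun d y => d = l.countP fun z => H.Adj y z) (codeDegrees p) l := by
  induction p generalizing l with
  | nil =>
    cases l with
    | nil => exact .nil
    | cons x l => exact h.elim
  | cons c p ih =>
    cases l with
    | nil => exact h.elim
    | cons x l =>
      refine .cons ?_ ?_
      · have key : ∀ {c : List Bool} {l : List W},
            List.Forall₂ (fun b y => x ≠ y ∧ (H.Adj x y ↔ b = true)) c l →
            c.count true = l.countP fun z => H.Adj x z := by
          intro c l hl
          induction hl with
          | nil => rfl
          | @cons b y c l hb _ ih =>
            rw [List.countP_cons, List.count_cons, ih]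
            simp [hb.2]
        simpa using key h.1
      · have key : ∀ {ds : List ℕ} {c : List Bool} {l l' : List W},
            List.Forall₂ (fun b y => x ≠ y ∧ (H.Adj x y ↔ b = true)) c l →
            List.Forall₂ (fun d y => d = l'.countP fun z => H.Adj y z) ds l →
            List.Forall₂ (fun d y => d = (x :: l').countP fun z => H.Adj y z)
              (List.zipWith (fun b d => bif b then d + 1 else d) c ds) l := by
          intro ds c l l' hc hd
          induction hd generalizing c with
          | nil => cases hc; exact .nil
          | @cons d y ds l hd _ ih =>
            cases hc with
            | @cons b _ c _ hb hc =>
              refine .cons ?_ (ih hc)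
              have := hb.2
              rw [adj_comm] at this
              rw [List.countP_cons, hd]
              cases b <;> simp_all
        exact key h.1 (ih h.2)

variable [Fintype W]

/-- `H` has maximum degree at most `k` and cannot be colored from the lists `L` of size `k - 1`,
but all its proper induced subgraphs can. -/
structure IsListCritical (H : SimpleGraph W) [DecidableRel H.Adj] (k : ℕ) (L : W → Finset ℕ) :
    Prop where
  degree_le (x : W) : H.degree x ≤ k
  card_eq (x : W) : (L x).card = k - 1
  not_good : ¬ H.IsGoodListAssignment L
  exists_coloring (T : Finset W) : T.Nonempty → ∃ g : W → ℕ, (∀ x ∉ T, g x ∈ L x) ∧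
    ∀ x ∉ T, ∀ y ∉ T, H.Adj x y → g x ≠ g y

variable {H : SimpleGraph W} [DecidableRel H.Adj] {k : ℕ} {L : W → Finset ℕ}

/-- Color everything outside `T` and remove from each list the colors of the neighbors outside `T`.
A coloring of `T` from the remaining lists would complete a coloring of `H`. -/
theorem IsListCritical.exists_residual_lists [DecidableEq W] (h : IsListCritical H k L)
    {T : Finset W} (hT : T.Nonempty) :
    ∃ S : W → Finset ℕ, (∀ y, k - 1 ≤ (S y).card + (H.neighborFinset y \ T).card) ∧
      ∀ g : W → ℕ, (∀ y ∈ T, g y ∈ S y) → ¬ ∀ y ∈ T, ∀ z ∈ T, H.Adj y z → g y ≠ g z := by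
  obtain ⟨c, hc, hc'⟩ := h.exists_coloring T hT
  refine ⟨fun y => L y \ (H.neighborFinset y \ T).image c, fun y => ?_, fun g hg hg' => ?_⟩
  · beta_reduce
    rw [← h.card_eq y]
    have h1 := Finset.le_card_sdiff ((H.neighborFinset y \ T).image c) (L y)
    have h2 : ((H.neighborFinset y \ T).image c).card ≤ (H.neighborFinset y \ T).card :=
      Finset.card_image_le
    omega
  · refine h.not_good ⟨Coloring.mk (fun y => if y ∈ T then g y else c y) ?_, fun y => ?_⟩
    · intro y z hyz
      have mixed (y z : W) (hy : y ∈ T) (hz : z ∉ T) (hyz : H.Adj y z) : g y ≠ c z := fun heq =>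
        (Finset.mem_sdiff.1 (hg y hy)).2 (heq ▸ Finset.mem_image_of_mem c (by simp [hyz, hz]))
      by_cases hy : y ∈ T <;> by_cases hz : z ∈ T <;> simp only [hy, hz, if_true, if_false]
      · exact hg' y hy z hz hyz
      · exact mixed y z hy hz hyz
      · exact (mixed z y hz hy hyz.symm).symm
      · exact hc' y hy z hz hyz
    · change (if y ∈ T then g y else c y) ∈ L y
      split_ifs with hy
      · exact (Finset.mem_sdiff.1 (hg y hy)).1
      · exact hc y hy

theorem IsListCritical.le_degree (h : IsListCritical H k L) (x : W) : k - 1 ≤ H.degree x := by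
  classical
  by_contra! hlt
  obtain ⟨S, hS, hS'⟩ := h.exists_residual_lists (Finset.singleton_nonempty x)
  have h1 := hS x
  have h2 : (H.neighborFinset x \ {x}).card ≤ H.degree x := by
    rw [← card_neighborFinset_eq_degree]
    exact Finset.card_le_card Finset.sdiff_subset
  obtain ⟨a, ha⟩ : (S x).Nonempty := Finset.card_pos.1 (by omega)
  refine hS' (fun _ => a) (by simpa using ha) fun y hy z hz hyz => ?_
  rw [Finset.mem_singleton.1 hy, Finset.mem_singleton.1 hz] at hyz
  exact (hyz.ne rfl).elim

/-- Whether the coded graph can be colored from all lists that are shorter by one than the degrees,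
as certified by the outdegrees `ts`. -/
def isReducible (p : List (List Bool)) (ts : List ℕ) : Bool :=
  orientationSum p ts != 0 && (List.length ts == p.length &&
    (List.zipWith (fun t d => decide (t + 2 ≤ d)) ts (codeDegrees p)).all id)

/-- A vertex with $d$ neighbors in the copy has at most $k-d$ outside, so its residual list has at
least $(k-1)-(k-d)=d-1$ colors. This exceeds the outdegree $t$ as $t+2\le d$. -/
theorem IsListCritical.not_isCopy_of_isReducible (h : IsListCritical H k L)
    {p : List (List Bool)} {ts : List ℕ} (hp : isReducible p ts = true) (hne : p ≠ [])
    (l : List W) : ¬ IsCopy H p l := by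
  classical
  intro hl
  simp only [isReducible, Bool.and_eq_true, bne_iff_ne, beq_iff_eq] at hp
  obtain ⟨hsum, hlen, hdeg⟩ := hp
  have hT : l.toFinset.Nonempty := by
    rw [List.toFinset_nonempty_iff]
    rintro rfl
    exact hne (List.length_eq_zero_iff.1 hl.length_eq)
  obtain ⟨S, hS, hS'⟩ := h.exists_residual_lists hT
  have hbound (y : W) (t : ℕ) (ht : t + 2 ≤ l.countP fun z => H.Adj y z) : t < (S y).card := by
    have h1 := hS y
    have h2 := h.degree_le y
    rw [← card_neighborFinset_eq_degree, ← Finset.card_inter_add_card_sdiff _ l.toFinset] at h2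
    have h3 : (l.countP fun z => H.Adj y z) ≤ (H.neighborFinset y ∩ l.toFinset).card := by
      rw [List.countP_eq_length_filter,
        ← List.toFinset_card_of_nodup (hl.nodup.filter _)]
      refine Finset.card_le_card fun z hz => ?_
      simp only [List.mem_toFinset, List.mem_filter, decide_eq_true_eq] at hz
      simp [hz.1, hz.2]
    omega
  have hlists : List.Forall₂ (fun t y => t < (S y).card) ts l := by
    have key : ∀ {ds ts : List ℕ} {l' : List W}, ts.length = l'.length →
        List.Forall₂ (fun d y => d = l.countP fun z => H.Adj y z) ds l' →
        (List.zipWith (fun t d => decide (t + 2 ≤ d)) ts ds).all id = true →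
        List.Forall₂ (fun t y => t < (S y).card) ts l' := by
      intro ds ts l' hlen hd hall
      induction hd generalizing ts with
      | nil => rw [List.length_eq_zero_iff.1 hlen]; exact .nil
      | @cons d y ds l' hd _ ih =>
        cases ts with
        | nil => simp at hlen
        | cons t ts =>
          simp only [List.zipWith_cons_cons, List.all_cons, id, Bool.and_eq_true,
            decide_eq_true_eq] at hall
          exact .cons (hbound y t (hd ▸ hall.1)) (ih (by simpa using hlen) hall.2)
    exact key (hlen.trans hl.length_eq) hl.forall₂_codeDegrees hdeg
  obtain ⟨g, hg, hg'⟩ := hl.exists_coloring hsum hlists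
  exact hS' g (by simpa using hg) (by simpa using hg')

/-- The vertex `v` has at least $k-1\ge 8$ neighbors, and `l` has at most seven other vertices. -/
theorem IsListCritical.exists_adj_notMem (h : IsListCritical H k L) (hk : 9 ≤ k) {l : List W}
    {v : W} (hv : v ∈ l) (hl : l.length ≤ 8) : ∃ x ∉ l, H.Adj x v := by
  classical
  by_contra! hcon
  have hsub : insert v (H.neighborFinset v) ⊆ l.toFinset := by
    intro x hx
    rcases Finset.mem_insert.1 hx with rfl | hx
    · simpa using hv
    · by_contra hxl
      exact hcon x (by simpa using hxl) ((mem_neighborFinset _ _ _).1 hx).symm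
  have h1 := Finset.card_le_card hsub
  rw [Finset.card_insert_of_notMem (by simp), card_neighborFinset_eq_degree] at h1
  have h2 := h.le_degree v
  have h3 := l.toFinset_card_le
  omega

/-- Otherwise all neighbors of `u` are `v` or lie in $N(v)\setminus\{u,a,b\}$, so `u` has degree at
most $1+(k-3)<k-1$. -/
theorem IsListCritical.exists_adj_not_adj (h : IsListCritical H k L) (hk : 9 ≤ k) {u v a b : W}
    (hvu : H.Adj v u) (hva : H.Adj v a) (hvb : H.Adj v b) (hab : a ≠ b) (hua : u ≠ a)
    (hub : u ≠ b) (hua' : ¬ H.Adj u a) (hub' : ¬ H.Adj u b) :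
    ∃ w, H.Adj w u ∧ ¬ H.Adj w v ∧ w ≠ v := by
  classical
  by_contra! hcon
  have hsub : H.neighborFinset u ⊆ insert v (H.neighborFinset v \ {u, a, b}) := by
    intro w hw
    rw [mem_neighborFinset] at hw
    by_cases hwv : w = v
    · simp [hwv]
    · have hadj : H.Adj v w := by
        by_contra hn
        exact hwv (hcon w hw.symm fun h' => hn h'.symm)
      refine Finset.mem_insert_of_mem (Finset.mem_sdiff.2 ⟨by simpa using hadj, ?_⟩)
      simp only [Finset.mem_insert, Finset.mem_singleton, not_or]
      exact ⟨hw.ne', fun h' => hua' (h' ▸ hw), fun h' => hub' (h' ▸ hw)⟩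
  have h1 := (Finset.card_le_card hsub).trans (Finset.card_insert_le _ _)
  have hsub' : ({u, a, b} : Finset W) ⊆ H.neighborFinset v := by
    intro w hw
    simp only [Finset.mem_insert, Finset.mem_singleton] at hw
    rcases hw with rfl | rfl | rfl <;> simpa
  rw [Finset.card_sdiff_of_subset hsub', Finset.card_eq_three.2 ⟨u, a, b, hua, hub, hab, rfl⟩,
    card_neighborFinset_eq_degree, card_neighborFinset_eq_degree] at h1
  have h2 := h.le_degree u
  have h3 := h.degree_le v
  omega

end Critical

/-! ### Forbidden induced subgraphs and one-vertex extensions. -/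

section Exclusion

variable {W : Type*}

/-- Graphs that can be colored from all lists shorter by one than the degrees, each with the
outdegrees that certify this. -/
def reducibleCodes : List (List ℕ × List ℕ) :=
  [([31, 11, 5, 3, 1, 0], [2, 2, 2, 2, 2, 3]),
   ([29, 14, 3, 3, 1, 0], [2, 2, 2, 2, 2, 2]),
   ([27, 21, 15, 7, 3, 1, 0], [2, 1, 3, 1, 3, 3, 4]),
   ([54, 12, 15, 7, 2, 1, 0], [2, 1, 2, 3, 3, 3, 1]),
   ([59, 25, 15, 7, 3, 1, 0], [3, 1, 2, 3, 2, 3, 4]),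
   ([31, 22, 13, 7, 3, 1, 0], [1, 1, 3, 2, 4, 3, 3]),
   ([27, 30, 12, 7, 3, 1, 0], [2, 1, 2, 4, 3, 3, 1]),
   ([101, 25, 23, 15, 3, 3, 1, 0], [2, 1, 1, 4, 2, 3, 2, 5]),
   ([27, 38, 31, 15, 7, 3, 1, 0], [2, 1, 1, 2, 3, 4, 5, 4]),
   ([98, 33, 23, 15, 7, 3, 1, 0], [1, 1, 4, 1, 2, 2, 4, 4]),
   ([35, 63, 28, 3, 12, 6, 2, 1, 0], [1, 4, 1, 1, 2, 2, 3, 4, 2]),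
   ([57, 54, 11, 15, 4, 3, 2, 1, 0], [2, 1, 1, 4, 1, 2, 2, 4, 3])]

theorem isReducible_of_mem_reducibleCodes {e : List ℕ × List ℕ} (he : e ∈ reducibleCodes) :
    isReducible (decode e.1) e.2 = true ∧ e.1 ≠ [] := by
  have h : reducibleCodes.all (fun e => isReducible (decode e.1) e.2 && e.1 != []) = true := by
    decide +kernel
  simpa using List.all_eq_true.1 h e he

/-- The claw and the reducible graphs. -/
def forbiddenCodes : List (List ℕ) := [1, 1, 1, 0] :: reducibleCodes.map Prod.fst

/-- `coversExtensions` for numerical codes, where the hints refer to `forbiddenCodes`. -/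
noncomputable def coversCodes (r : List ℕ) (s : List (Option Bool)) (hints : List (ℕ × ℕ))
    (targets : List (List ℕ)) : Bool :=
  coversExtensions (decode r) s
    (hints.map fun h => (decode (forbiddenCodes.getD h.1 [1, 1, 1, 0]), h.2)) (targets.map decode)

/-- Some vertices of `H` induce the graph coded by `r`. -/
def Occurs (H : SimpleGraph W) (r : List ℕ) : Prop := ∃ l, IsCopy H (decode r) l

theorem IsClawFree.not_occurs {H : SimpleGraph W} (h : H.IsClawFree) : ¬ Occurs H [1, 1, 1, 0] := by
  rintro ⟨l, hl⟩
  have hlen := hl.length_eq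
  obtain ⟨a, b, c, o, rfl⟩ : ∃ a b c o, l = [a, b, c, o] := by
    rcases l with _ | ⟨a, _ | ⟨b, _ | ⟨c, _ | ⟨o, _ | ⟨_, _⟩⟩⟩⟩⟩ <;> simp [decode] at hlen ⊢
  simp [IsCopy, decode, binaryDigits] at hl
  obtain ⟨⟨⟨hab, nab⟩, ⟨hac, nac⟩, hao, ao⟩, ⟨⟨hbc, nbc⟩, hbo, bo⟩, hco, co⟩ := hl
  replace nab : ¬ H.Adj a b := by rw [nab]; decide
  replace nac : ¬ H.Adj a c := by rw [nac]; decide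
  replace nbc : ¬ H.Adj b c := by rw [nbc]; decide
  let f : Fin 1 ⊕ Fin 3 → W := Sum.elim (fun _ => o) ![a, b, c]
  refine h ⟨⟨⟨f, ?_⟩, fun {i j} => ?_⟩⟩
  · rintro (i | i) (j | j) <;> fin_cases i <;> fin_cases j <;>
      simp [f, hab, hac, hbc, hao, hbo, hco, Ne.symm hab, Ne.symm hac, Ne.symm hbc, Ne.symm hao,
        Ne.symm hbo, Ne.symm hco]
  · change H.Adj (f i) (f j) ↔ _
    rcases i with i | i <;> rcases j with j | j <;> fin_cases i <;> fin_cases j <;>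
      simp [f, nab, nac, nbc, ao, bo, co, ao.symm, bo.symm, co.symm, H.adj_comm b a,
        H.adj_comm c a, H.adj_comm c b]

/-- Adjacency in a coded graph. -/
def codeAdj (p : List (List Bool)) (i j : ℕ) : Bool :=
  (p.getD (min i j) []).getD (max i j - min i j - 1) false

theorem IsCopy.adj_getElem_iff_of_lt {H : SimpleGraph W} {p : List (List Bool)} {l : List W}
    (h : IsCopy H p l) {i j : ℕ} (hij : i < j) (hj : j < l.length) :
    H.Adj l[i] l[j] ↔ (p.getD i []).getD (j - i - 1) false = true := by
  induction p generalizing l i j with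
  | nil =>
    cases l with
    | nil => simp at hj
    | cons x l => exact h.elim
  | cons c p ih =>
    cases l with
    | nil => exact h.elim
    | cons x l =>
      obtain ⟨j, rfl⟩ : ∃ j', j = j' + 1 := ⟨j - 1, by omega⟩
      cases i with
      | zero =>
        have hj' : j < l.length := by simpa using hj
        have hjc : j < c.length := h.1.length_eq ▸ hj'
        change H.Adj x l[j] ↔ c.getD j false = true
        rw [List.getD_eq_getElem _ _ hjc]
        exact (h.1.get hjc hj').2
      | succ i => simpa using ih h.2 (by omega : i < j) (by simpa using hj)

theorem IsCopy.adj_getElem_iff {H : SimpleGraph W} {p : List (List Bool)} {l : List W}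
    (h : IsCopy H p l) {i j : ℕ} (hi : i < l.length) (hj : j < l.length) (hij : i ≠ j) :
    H.Adj l[i] l[j] ↔ codeAdj p i j = true := by
  rcases hij.lt_or_gt with hij | hij
  · simpa [codeAdj, hij.le] using h.adj_getElem_iff_of_lt hij hj
  · simpa [codeAdj, hij.le, adj_comm] using h.adj_getElem_iff_of_lt hij hi

/-- Prescribes that a new vertex is adjacent to the last one of `n + 1` vertices. -/
def adjacentToLast (n : ℕ) : List (Option Bool) := List.replicate n none ++ [some true]

/-- Prescribes that a new vertex is adjacent to vertex `i` and not to the last one of `n + 1`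
vertices. -/
def adjacentNotToLast (n i : ℕ) : List (Option Bool) :=
  (List.replicate n none).set i (some true) ++ [some false]

/-- Whether, in the graph coded by `p` on `n + 1` vertices, the vertices `i`, `a`, `b` are distinct
neighbors of the last one, `i` is adjacent to neither `a` nor `b`, and all neighbors of `i` are
adjacent to the last vertex. -/
def needsOuterNeighbor (p : List (List Bool)) (n i a b : ℕ) : Bool :=
  codeAdj p i n && codeAdj p a n && codeAdj p b n && !codeAdj p i a && !codeAdj p i b &&
    decide (p.length = n + 1 ∧ i < n ∧ a < n ∧ b < n ∧ i ≠ a ∧ i ≠ b ∧ a ≠ b) &&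
    (List.range n).all fun j => codeAdj p j n || !codeAdj p j i

theorem forall₂_replicate_none {P : Option Bool → W → Prop} (hP : ∀ y, P none y) (l : List W) :
    List.Forall₂ P (List.replicate l.length none) l := by
  induction l with
  | nil => exact .nil
  | cons y l ih => exact .cons (hP y) ih

theorem forall₂_set_some {P : Option Bool → W → Prop} (hP : ∀ y, P none y) {l : List W}
    {i : ℕ} (hi : i < l.length) {b : Bool} (hb : P (some b) l[i]) :
    List.Forall₂ P ((List.replicate l.length none).set i (some b)) l := by
  induction l generalizing i with
  | nil => simp at hi
  | cons y l ih =>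
    cases i with
    | zero => exact .cons hb (forall₂_replicate_none hP l)
    | succ i => exact .cons (hP y) (ih (by simpa using hi) hb)

variable [Fintype W] {H : SimpleGraph W} [DecidableRel H.Adj] {k : ℕ} {L : W → Finset ℕ}

theorem IsListCritical.not_occurs_of_mem_forbiddenCodes (h : IsListCritical H k L)
    (hclaw : H.IsClawFree) {r : List ℕ} (hr : r ∈ forbiddenCodes) : ¬ Occurs H r := by
  rcases List.mem_cons.1 hr with rfl | hr
  · exact hclaw.not_occurs
  · obtain ⟨e, he, rfl⟩ := List.mem_map.1 hr
    obtain ⟨h1, h2⟩ := isReducible_of_mem_reducibleCodes he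
    rintro ⟨l, hl⟩
    refine h.not_isCopy_of_isReducible h1 (fun h' => h2 ?_) l hl
    cases he1 : e.1 <;> simp_all [decode]

theorem IsListCritical.exists_occurs_of_coversCodes (h : IsListCritical H k L)
    (hclaw : H.IsClawFree) {r : List ℕ} {l : List W} (hl : IsCopy H (decode r) l)
    {s : List (Option Bool)} {hints : List (ℕ × ℕ)} {targets : List (List ℕ)}
    (hc : coversCodes r s hints targets = true) {x : W} (hx : x ∉ l)
    (hs : List.Forall₂ (fun o y => ∀ b ∈ o, (H.Adj x y ↔ b = true)) s l) :
    ∃ t ∈ targets, Occurs H t := by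
  have : Nonempty W := ⟨x⟩
  rcases hl.exists_of_coversExtensions hc hx hs with ⟨e, he, h'⟩ | ⟨p, hp, h'⟩
  · obtain ⟨q, -, rfl⟩ := List.mem_map.1 he
    refine (h.not_occurs_of_mem_forbiddenCodes hclaw ?_ h').elim
    -- An index out of range is harmless, since the default value is the claw.
    by_cases hq : q.1 < forbiddenCodes.length
    · rw [List.getD_eq_getElem _ _ hq]
      exact List.getElem_mem hq
    · rw [List.getD_eq_default _ _ (by omega)]
      exact List.mem_cons_self
  · obtain ⟨t, ht, rfl⟩ := List.mem_map.1 hp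
    exact ⟨t, ht, h'⟩

theorem IsListCritical.exists_occurs_of_neighbor (h : IsListCritical H k L) (hk : 9 ≤ k)
    (hclaw : H.IsClawFree) {r : List ℕ} (hr : Occurs H r) {n : ℕ}
    (hn : (decode r).length = n + 1) (hn8 : n < 8) {hints : List (ℕ × ℕ)}
    {targets : List (List ℕ)} (hc : coversCodes r (adjacentToLast n) hints targets = true) :
    ∃ t ∈ targets, Occurs H t := by
  obtain ⟨l, hl⟩ := hr
  have hlen : l.length = n + 1 := hl.length_eq.symm.trans hn
  obtain ⟨l, v, rfl⟩ := (List.eq_nil_or_concat' l).resolve_left (by rintro rfl; simp at hlen : l ≠ [])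
  obtain ⟨x, hx, hxv⟩ := h.exists_adj_notMem hk (by simp : v ∈ l ++ [v]) (by omega)
  refine h.exists_occurs_of_coversCodes hclaw hl hc hx ?_
  simp only [List.length_append, List.length_singleton, Nat.add_right_cancel_iff] at hlen
  rw [adjacentToLast, ← hlen]
  exact List.rel_append (forall₂_replicate_none (by simp) l) (.cons (by simpa using hxv) .nil)

/-- Unlike the extension by a neighbor of the last vertex, this one has no limit on the number of
vertices. The new vertex is not in `l`, because all neighbors of vertex `i` in `l` are adjacent to
the last vertex. -/
theorem IsListCritical.exists_occurs_of_outer_neighbor (h : IsListCritical H k L) (hk : 9 ≤ k)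
    (hclaw : H.IsClawFree) {r : List ℕ} (hr : Occurs H r) {n i a b : ℕ}
    (hn : needsOuterNeighbor (decode r) n i a b = true) {hints : List (ℕ × ℕ)}
    {targets : List (List ℕ)} (hc : coversCodes r (adjacentNotToLast n i) hints targets = true) :
    ∃ t ∈ targets, Occurs H t := by
  obtain ⟨l, hl⟩ := hr
  simp only [needsOuterNeighbor, Bool.and_eq_true, decide_eq_true_eq, Bool.not_eq_true',
    List.all_eq_true, List.mem_range, Bool.or_eq_true] at hn
  obtain ⟨⟨⟨⟨⟨⟨hin, han⟩, hbn⟩, hia⟩, hib⟩, hp, hi, ha, hb, nia, nib, nab⟩, hall⟩ := hn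
  have hlen : l.length = n + 1 := hl.length_eq.symm.trans hp
  have adj {i j : ℕ} (hi : i < n + 1) (hj : j < n + 1) (hij : i ≠ j) :
      H.Adj l[i] l[j] ↔ codeAdj (decode r) i j = true :=
    hl.adj_getElem_iff (by omega) (by omega) hij
  have inj {i j : ℕ} (hi : i < n + 1) (hj : j < n + 1) (hij : i ≠ j) : l[i] ≠ l[j] := fun h' =>
    hij ((hl.nodup.getElem_inj_iff).1 h')
  obtain ⟨w, hwu, hwv, hne⟩ := h.exists_adj_not_adj hk (u := l[i]) (v := l[n]) (a := l[a])
    (b := l[b]) ((adj (by omega) (by omega) (by omega)).2 hin).symm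
    ((adj (by omega) (by omega) (by omega)).2 han).symm
    ((adj (by omega) (by omega) (by omega)).2 hbn).symm
    (inj (by omega) (by omega) nab) (inj (by omega) (by omega) nia) (inj (by omega) (by omega) nib)
    (by rw [adj (by omega) (by omega) nia, hia]; simp)
    (by rw [adj (by omega) (by omega) nib, hib]; simp)
  have hw : w ∉ l := by
    intro hw
    obtain ⟨j, hj, rfl⟩ := List.getElem_of_mem hw
    have hjn : j ≠ n := by rintro rfl; exact hne rfl
    have hji : j ≠ i := by rintro rfl; exact hwu.ne rfl
    rcases hall j (by omega) with h' | h'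
    · exact hwv ((adj (by omega) (by omega) hjn).2 h')
    · rw [adj (by omega) (by omega) hji, h'] at hwu
      simp at hwu
  refine h.exists_occurs_of_coversCodes hclaw hl hc hw ?_
  obtain ⟨l, v, rfl⟩ := (List.eq_nil_or_concat' l).resolve_left (by rintro rfl; simp at hlen : l ≠ [])
  simp only [List.length_append, List.length_singleton, Nat.add_right_cancel_iff] at hlen
  subst hlen
  rw [adjacentNotToLast]
  refine List.rel_append (forall₂_set_some (by simp) hi ?_) (.cons ?_ .nil)
  · simpa [List.getElem_append_left hi] using hwu
  · simpa using hwv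

end Exclusion

/-! ### Excluding the 5-wheel and the cone over the complement of a 6-vertex path. -/

section Wheel

variable {W : Type*} [Fintype W] {H : SimpleGraph W} [DecidableRel H.Adj] {k : ℕ}
  {L : W → Finset ℕ}

/-- The hub is the last vertex throughout. Up to nine vertices, the graph grows by neighbors of the
hub; after that, by a neighbor of a chosen vertex that is not adjacent to the hub. Each extension
contains a forbidden graph or is, up to relabeling, one of the targets. -/
theorem IsListCritical.not_occurs_wheel (h : IsListCritical H k L) (hk : 9 ≤ k)
    (hclaw : H.IsClawFree) : ¬ Occurs H [13, 7, 3, 1, 1, 0] := by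
  -- The name of each fact lists the codes of the vertices added to the wheel, in order of addition.
  -- The largest graphs come first, because smaller ones reduce to them. A hint is an index in
  -- `forbiddenCodes` with the place of the new vertex in that graph.
  have h23_43_117_138 : ¬ Occurs H [138, 117, 43, 23, 13, 7, 3, 1, 1, 0] := fun hr => by
    obtain ⟨t, ht, -⟩ := h.exists_occurs_of_outer_neighbor hk hclaw hr (n := 9) (i := 7) (a := 8)
      (b := 6) (hints := [(0, 0), (1, 1), (4, 0), (3, 0), (12, 0), (11, 0)])
      (targets := [])
      (by decide +kernel) (by decide +kernel)
    simp at ht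
  have h23_43_117 : ¬ Occurs H [117, 43, 23, 13, 7, 3, 1, 1, 0] := fun hr => by
    obtain ⟨t, ht, ho⟩ := h.exists_occurs_of_outer_neighbor hk hclaw hr (n := 8) (i := 5) (a := 6)
      (b := 4) (hints := [(0, 0), (1, 1), (4, 0)])
      (targets := [[138, 117, 43, 23, 13, 7, 3, 1, 1, 0]])
      (by decide +kernel) (by decide +kernel)
    simp only [List.mem_cons, List.not_mem_nil, or_false] at ht
    subst ht
    exact h23_43_117_138 ho
  have h23_43_87 : ¬ Occurs H [87, 43, 23, 13, 7, 3, 1, 1, 0] := fun hr => by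
    obtain ⟨t, ht, -⟩ := h.exists_occurs_of_outer_neighbor hk hclaw hr (n := 8) (i := 4) (a := 5)
      (b := 3) (hints := [(0, 0), (4, 0), (1, 1), (10, 0), (5, 1)])
      (targets := [])
      (by decide +kernel) (by decide +kernel)
    simp at ht
  have h23_43_219 : ¬ Occurs H [219, 43, 23, 13, 7, 3, 1, 1, 0] := fun hr => by
    obtain ⟨t, ht, -⟩ := h.exists_occurs_of_outer_neighbor hk hclaw hr (n := 8) (i := 7) (a := 6)
      (b := 3) (hints := [(0, 0), (1, 1), (3, 0)])
      (targets := [])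
      (by decide +kernel) (by decide +kernel)
    simp at ht
  have h23_59_109 : ¬ Occurs H [109, 59, 23, 13, 7, 3, 1, 1, 0] := fun hr => by
    obtain ⟨t, ht, -⟩ := h.exists_occurs_of_outer_neighbor hk hclaw hr (n := 8) (i := 7) (a := 6)
      (b := 3) (hints := [(0, 0), (1, 1), (2, 0)])
      (targets := [])
      (by decide +kernel) (by decide +kernel)
    simp at ht
  have h23_87_215 : ¬ Occurs H [215, 87, 23, 13, 7, 3, 1, 1, 0] := fun hr => by
    obtain ⟨t, ht, -⟩ := h.exists_occurs_of_outer_neighbor hk hclaw hr (n := 8) (i := 4) (a := 5)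
      (b := 3) (hints := [(0, 0), (4, 0), (1, 1), (10, 0), (5, 1), (6, 1)])
      (targets := [])
      (by decide +kernel) (by decide +kernel)
    simp at ht
  have h23_91 : ¬ Occurs H [91, 23, 13, 7, 3, 1, 1, 0] := fun hr => by
    obtain ⟨t, ht, ho⟩ := h.exists_occurs_of_neighbor hk hclaw hr (n := 7)
      (hints := [(0, 0), (5, 0), (8, 1), (8, 3), (1, 1), (3, 2), (9, 3)])
      (targets := [[117, 43, 23, 13, 7, 3, 1, 1, 0],
        [219, 43, 23, 13, 7, 3, 1, 1, 0]])
      rfl (by norm_num) (by decide +kernel)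
    simp only [List.mem_cons, List.not_mem_nil, or_false] at ht
    rcases ht with rfl | rfl
    exacts [h23_43_117 ho, h23_43_219 ho]
  have h23_87 : ¬ Occurs H [87, 23, 13, 7, 3, 1, 1, 0] := fun hr => by
    obtain ⟨t, ht, ho⟩ := h.exists_occurs_of_neighbor hk hclaw hr (n := 7)
      (hints := [(0, 0), (8, 3), (3, 1), (1, 1), (3, 2), (6, 1), (9, 2)])
      (targets := [[87, 43, 23, 13, 7, 3, 1, 1, 0],
        [215, 87, 23, 13, 7, 3, 1, 1, 0]])
      rfl (by norm_num) (by decide +kernel)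
    simp only [List.mem_cons, List.not_mem_nil, or_false] at ht
    rcases ht with rfl | rfl
    exacts [h23_43_87 ho, h23_87_215 ho]
  have h23_59 : ¬ Occurs H [59, 23, 13, 7, 3, 1, 1, 0] := fun hr => by
    obtain ⟨t, ht, ho⟩ := h.exists_occurs_of_neighbor hk hclaw hr (n := 7)
      (hints := [(0, 0), (3, 5), (1, 0), (8, 2), (1, 1)])
      (targets := [[109, 59, 23, 13, 7, 3, 1, 1, 0]])
      rfl (by norm_num) (by decide +kernel)
    simp only [List.mem_cons, List.not_mem_nil, or_false] at ht
    subst ht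
    exact h23_59_109 ho
  have h23_47 : ¬ Occurs H [47, 23, 13, 7, 3, 1, 1, 0] := fun hr => by
    obtain ⟨t, ht, -⟩ := h.exists_occurs_of_neighbor hk hclaw hr (n := 7)
      (hints := [(0, 0), (3, 2), (8, 6), (8, 2), (1, 0), (6, 0), (5, 2), (3, 5)])
      (targets := [])
      rfl (by norm_num) (by decide +kernel)
    simp at ht
  have h23_43 : ¬ Occurs H [43, 23, 13, 7, 3, 1, 1, 0] := fun hr => by
    obtain ⟨t, ht, ho⟩ := h.exists_occurs_of_neighbor hk hclaw hr (n := 7)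
      (hints := [(0, 0), (8, 3), (3, 2)])
      (targets := [[87, 43, 23, 13, 7, 3, 1, 1, 0],
        [117, 43, 23, 13, 7, 3, 1, 1, 0],
        [219, 43, 23, 13, 7, 3, 1, 1, 0]])
      rfl (by norm_num) (by decide +kernel)
    simp only [List.mem_cons, List.not_mem_nil, or_false] at ht
    rcases ht with rfl | rfl | rfl
    exacts [h23_43_87 ho, h23_43_117 ho, h23_43_219 ho]
  have h63 : ¬ Occurs H [63, 13, 7, 3, 1, 1, 0] := fun hr => by
    obtain ⟨t, ht, -⟩ := h.exists_occurs_of_neighbor hk hclaw hr (n := 6)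
      (hints := [(0, 0), (1, 1), (3, 5), (5, 2)])
      (targets := [])
      rfl (by norm_num) (by decide +kernel)
    simp at ht
  have h31 : ¬ Occurs H [31, 13, 7, 3, 1, 1, 0] := fun hr => by
    obtain ⟨t, ht, ho⟩ := h.exists_occurs_of_neighbor hk hclaw hr (n := 6)
      (hints := [(0, 0), (1, 0), (7, 4), (8, 2), (1, 1), (3, 5), (5, 2)])
      (targets := [[47, 23, 13, 7, 3, 1, 1, 0],
        [59, 23, 13, 7, 3, 1, 1, 0]])
      rfl (by norm_num) (by decide +kernel)
    simp only [List.mem_cons, List.not_mem_nil, or_false] at ht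
    rcases ht with rfl | rfl
    exacts [h23_47 ho, h23_59 ho]
  have h23 : ¬ Occurs H [23, 13, 7, 3, 1, 1, 0] := fun hr => by
    obtain ⟨t, ht, ho⟩ := h.exists_occurs_of_neighbor hk hclaw hr (n := 6)
      (hints := [(0, 0), (8, 3), (3, 2), (1, 1)])
      (targets := [[43, 23, 13, 7, 3, 1, 1, 0],
        [47, 23, 13, 7, 3, 1, 1, 0],
        [59, 23, 13, 7, 3, 1, 1, 0],
        [87, 23, 13, 7, 3, 1, 1, 0],
        [91, 23, 13, 7, 3, 1, 1, 0]])
      rfl (by norm_num) (by decide +kernel)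
    simp only [List.mem_cons, List.not_mem_nil, or_false] at ht
    rcases ht with rfl | rfl | rfl | rfl | rfl
    exacts [h23_43 ho, h23_47 ho, h23_59 ho, h23_87 ho, h23_91 ho]
  intro hr
  -- Without a claw at the hub, the rim vertices not adjacent to the new vertex form a clique of
  -- $C_5$. So it sees three consecutive rim vertices (23), four (31) or all five (63).
  obtain ⟨t, ht, ho⟩ := h.exists_occurs_of_neighbor hk hclaw hr (n := 5)
    (hints := [(0, 0)])
    (targets := [[23, 13, 7, 3, 1, 1, 0],
      [31, 13, 7, 3, 1, 1, 0],
      [63, 13, 7, 3, 1, 1, 0]])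
    rfl (by norm_num) (by decide +kernel)
  simp only [List.mem_cons, List.not_mem_nil, or_false] at ht
  rcases ht with rfl | rfl | rfl
  exacts [h23 ho, h31 ho, h63 ho]

/-- Both codes have seven vertices, so the search exhibits an isomorphism with a reducible graph.
The position `7` is out of range and prescribes nothing. -/
theorem IsListCritical.not_occurs_cone_path_compl (h : IsListCritical H k L)
    (hclaw : H.IsClawFree) : ¬ Occurs H [31, 15, 7, 3, 1, 1, 0] := by
  rintro ⟨l, hl⟩
  have hne : Nonempty W := by
    rcases l with _ | ⟨x, _⟩
    · exact hl.elim
    · exact ⟨x⟩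
  exact h.not_occurs_of_mem_forbiddenCodes hclaw
    (by simp [forbiddenCodes, reducibleCodes] : [27, 30, 12, 7, 3, 1, 0] ∈ forbiddenCodes)
    (hl.exists_of_hasCopyAt (q := 7) (by decide +kernel))

end Wheel

/-! ### Odd cycles in the complement of a neighborhood. -/

section OddCycle

/-- A shortest odd closed walk is an induced cycle. -/
theorem exists_induced_odd_cycle {α : Type*} {F : SimpleGraph α} {u : α} (w : F.Walk u u)
    (hw : Odd w.length) : ∃ (n : ℕ) (p : ℕ → α), Odd n ∧ 3 ≤ n ∧ ∀ i j, i < j → j < n →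
      p i ≠ p j ∧ (F.Adj (p i) (p j) ↔ j = i + 1 ∨ i = 0 ∧ j + 1 = n) := by
  classical
  have hex : ∃ n, Odd n ∧ ∃ p : ℕ → α, p n = p 0 ∧ ∀ i < n, F.Adj (p i) (p (i + 1)) :=
    ⟨w.length, hw, w.getVert, by simp, fun i hi => w.adj_getVert_succ hi⟩
  obtain ⟨n, ⟨hn, p, hp0, hp⟩, hmin⟩ : ∃ n, (Odd n ∧ ∃ p : ℕ → α, p n = p 0 ∧
      ∀ i < n, F.Adj (p i) (p (i + 1))) ∧ ∀ m < n, ¬ (Odd m ∧ ∃ p : ℕ → α, p m = p 0 ∧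
      ∀ i < m, F.Adj (p i) (p (i + 1))) :=
    ⟨Nat.find hex, Nat.find_spec hex, fun m hm => Nat.find_min hex hm⟩
  have hn3 : 3 ≤ n := by
    by_contra! hlt
    obtain rfl : n = 1 := by obtain ⟨m, rfl⟩ := hn; omega
    exact (hp 0 one_pos).ne hp0.symm
  -- A repeated vertex or a chord splits the closed walk in two. By parity one of the parts is odd,
  -- and it is shorter than `n`.
  refine ⟨n, p, hn, hn3, fun i j hij hj => ⟨fun heq => ?_, ?_, ?_⟩⟩
  · rcases Nat.even_or_odd (j - i) with hpar | hpar
    · have hodd : Odd (n - (j - i)) := by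
        rw [Nat.odd_sub (by omega)]
        exact iff_of_true hn hpar
      refine hmin (n - (j - i)) (by omega)
        ⟨hodd, fun t => if t ≤ i then p t else p (t + (j - i)), ?_, fun t ht => ?_⟩
      · simp only [show ¬ n - (j - i) ≤ i by omega, if_false, Nat.zero_le, if_true]
        rw [← hp0]
        congr 1
        omega
      · rcases lt_trichotomy t i with h | rfl | h
        · simpa [h.le, Nat.succ_le_of_lt h] using hp t (by omega)
        · simpa [heq, show t + 1 + (j - t) = j + 1 by omega] using hp j hj
        · simpa [show ¬ t ≤ i by omega, show ¬ t + 1 ≤ i by omega,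
            show t + 1 + (j - i) = t + (j - i) + 1 by omega] using hp (t + (j - i)) (by omega)
    · refine hmin (j - i) (by omega) ⟨hpar, fun t => p (i + t), ?_, fun t ht => ?_⟩
      · simpa [show i + (j - i) = j by omega] using heq.symm
      · exact hp (i + t) (by omega)
  · intro hadj
    by_contra! hcon
    obtain ⟨h1, h2⟩ := hcon
    rcases Nat.even_or_odd (j - i) with hpar | hpar
    · refine hmin (j - i + 1) (by omega)
        ⟨hpar.add_one, fun t => if t ≤ j - i then p (i + t) else p i, by simp, fun t ht => ?_⟩
      rcases Nat.lt_or_ge t (j - i) with h | h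
      · simpa [h.le, Nat.succ_le_of_lt h, add_assoc] using hp (i + t) (by omega)
      · obtain rfl : t = j - i := by omega
        simpa [show i + (j - i) = j by omega] using hadj.symm
    · have hev : Even (n - (j - i)) := by
        rw [Nat.even_sub (by omega)]
        exact iff_of_false (by simpa using hn) (by simpa using hpar)
      refine hmin (n - (j - i) + 1) (by omega)
        ⟨hev.add_one, fun t => if t ≤ i then p t else p (t + (j - i) - 1), ?_, fun t ht => ?_⟩
      · simp only [show ¬ n - (j - i) + 1 ≤ i by omega, if_false, Nat.zero_le, if_true]
        rw [← hp0]
        congr 1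
        omega
      · rcases lt_trichotomy t i with h | rfl | h
        · simpa [h.le, Nat.succ_le_of_lt h] using hp t (by omega)
        · simpa [show t + 1 + (j - t) - 1 = j by omega] using hadj
        · simpa [show ¬ t ≤ i by omega, show ¬ t + 1 ≤ i by omega,
            show t + 1 + (j - i) - 1 = t + (j - i) - 1 + 1 by omega] using
            hp (t + (j - i) - 1) (by omega)
  · rintro (rfl | ⟨rfl, h⟩)
    · exact hp i (by omega)
    · have := hp j hj
      rw [h, hp0] at this
      exact this.symm

variable {W : Type*} {H : SimpleGraph W}

/-- The color classes of a 2-coloring of the complement of $H[N(v)]$ would be two cliques covering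
$N(v)$. -/
theorem exists_odd_walk_of_not_isBisimplicial {v : W} (hv : ¬ H.IsBisimplicial v) :
    ∃ (u : H.neighborSet v) (w : (H.induce (H.neighborSet v))ᶜ.Walk u u), Odd w.length := by
  by_contra! hcon
  have hcol : (H.induce (H.neighborSet v))ᶜ.Colorable 2 :=
    two_colorable_iff_forall_loop_even.2 fun u w => Nat.not_odd_iff_even.1 (hcon u w)
  obtain ⟨c⟩ := hcol
  have hclique (a : Fin 2) : H.IsClique {x | ∃ hx : x ∈ H.neighborSet v, c ⟨x, hx⟩ = a} := by
    rintro x ⟨hx, hxa⟩ y ⟨hy, hya⟩ hxy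
    by_contra hn
    refine c.valid (v := ⟨x, hx⟩) (w := ⟨y, hy⟩) ?_ (hxa.trans hya.symm)
    simp [hxy, hn]
  refine hv ⟨_, _, hclique 0, hclique 1, fun x hx => ?_⟩
  rcases Fin.eq_zero_or_eq_succ (c ⟨x, hx⟩) with h | ⟨j, h⟩
  · exact Or.inl ⟨hx, h⟩
  · refine Or.inr ⟨hx, h.trans ?_⟩
    fin_cases j
    rfl

variable [Fintype W] [DecidableRel H.Adj] {k : ℕ} {L : W → Finset ℕ}

theorem IsListCritical.isQuasiLine (h : IsListCritical H k L) (hk : 9 ≤ k)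
    (hclaw : H.IsClawFree) : H.IsQuasiLine := by
  intro v
  by_contra hv
  obtain ⟨u, w, hw⟩ := exists_odd_walk_of_not_isBisimplicial hv
  obtain ⟨n, p, hn, hn3, hp⟩ := exists_induced_odd_cycle w hw
  have V (i : ℕ) : (p i : W) ≠ v ∧ (H.Adj (p i) v ↔ true = true) := by
    have : H.Adj v (p i) := (p i).2
    exact ⟨this.ne', by simpa using this.symm⟩
  -- The cycle lives in the complement: vertices not consecutive on it are adjacent in `H` (`A`),
  -- consecutive ones are not (`B`).
  have A (i j : ℕ) (hij : i + 1 < j) (hj : j < n) (h0 : i ≠ 0 ∨ j + 1 ≠ n) :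
      (p j : W) ≠ p i ∧ (H.Adj (p j) (p i) ↔ true = true) := by
    obtain ⟨h1, h2⟩ := hp i j (by omega) hj
    have h3 : ¬ (j = i + 1 ∨ i = 0 ∧ j + 1 = n) := by omega
    rw [← h2] at h3
    refine ⟨fun h' => h1 (Subtype.ext h'.symm), ?_⟩
    simp only [compl_adj, ne_eq, h1, not_false_eq_true, comap_adj, true_and, not_not,
      Function.Embedding.subtype_apply] at h3
    simpa using h3.symm
  have B (i j : ℕ) (hij : i < j) (hj : j < n) (h0 : j = i + 1 ∨ i = 0 ∧ j + 1 = n) :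
      (p j : W) ≠ p i ∧ (H.Adj (p j) (p i) ↔ false = true) := by
    obtain ⟨h1, h2⟩ := hp i j (by omega) hj
    have h3 := h2.2 h0
    refine ⟨fun h' => h1 (Subtype.ext h'.symm), ?_⟩
    simp only [compl_adj, ne_eq, h1, not_false_eq_true, comap_adj, true_and,
      Function.Embedding.subtype_apply] at h3
    simpa [H.adj_comm (p j : W)] using h3
  obtain rfl | rfl | hn7 : n = 3 ∨ n = 5 ∨ 7 ≤ n := by
    obtain ⟨m, rfl⟩ := hn
    omega
  · refine hclaw.not_occurs ⟨[p 2, p 1, p 0, v], ?_⟩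
    exact ⟨.cons (B 1 2 (by omega) (by omega) (by omega)) <|
        .cons (B 0 2 (by omega) (by omega) (by omega)) <| .cons (V 2) .nil,
      .cons (B 0 1 (by omega) (by omega) (by omega)) <| .cons (V 1) .nil,
      .cons (V 0) .nil, .nil, trivial⟩
  · refine h.not_occurs_wheel hk hclaw ⟨[p 4, p 3, p 2, p 1, p 0, v], ?_⟩
    exact ⟨.cons (B 3 4 (by omega) (by omega) (by omega)) <|
        .cons (A 2 4 (by omega) (by omega) (by omega)) <|
        .cons (A 1 4 (by omega) (by omega) (by omega)) <|
        .cons (B 0 4 (by omega) (by omega) (by omega)) <| .cons (V 4) .nil,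
      .cons (B 2 3 (by omega) (by omega) (by omega)) <|
        .cons (A 1 3 (by omega) (by omega) (by omega)) <|
        .cons (A 0 3 (by omega) (by omega) (by omega)) <| .cons (V 3) .nil,
      .cons (B 1 2 (by omega) (by omega) (by omega)) <|
        .cons (A 0 2 (by omega) (by omega) (by omega)) <| .cons (V 2) .nil,
      .cons (B 0 1 (by omega) (by omega) (by omega)) <| .cons (V 1) .nil,
      .cons (V 0) .nil, .nil, trivial⟩
  -- Six consecutive vertices of a cycle of length at least 7 form an induced path in the
  -- complement.
  · refine h.not_occurs_cone_path_compl hclaw ⟨[p 5, p 4, p 3, p 2, p 1, p 0, v], ?_⟩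
    exact ⟨.cons (B 4 5 (by omega) (by omega) (by omega)) <|
        .cons (A 3 5 (by omega) (by omega) (by omega)) <|
        .cons (A 2 5 (by omega) (by omega) (by omega)) <|
        .cons (A 1 5 (by omega) (by omega) (by omega)) <|
        .cons (A 0 5 (by omega) (by omega) (by omega)) <| .cons (V 5) .nil,
      .cons (B 3 4 (by omega) (by omega) (by omega)) <|
        .cons (A 2 4 (by omega) (by omega) (by omega)) <|
        .cons (A 1 4 (by omega) (by omega) (by omega)) <|
        .cons (A 0 4 (by omega) (by omega) (by omega)) <| .cons (V 4) .nil,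
      .cons (B 2 3 (by omega) (by omega) (by omega)) <|
        .cons (A 1 3 (by omega) (by omega) (by omega)) <|
        .cons (A 0 3 (by omega) (by omega) (by omega)) <| .cons (V 3) .nil,
      .cons (B 1 2 (by omega) (by omega) (by omega)) <|
        .cons (A 0 2 (by omega) (by omega) (by omega)) <| .cons (V 2) .nil,
      .cons (B 0 1 (by omega) (by omega) (by omega)) <| .cons (V 1) .nil,
      .cons (V 0) .nil, .nil, trivial⟩

end OddCycle

/-! ### Passing to a critical subgraph and adjusting the maximum degree. -/

section Reduction

/-- Two cliques with `5` and `k - 3` vertices that share one vertex. -/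
def bowtie (k : ℕ) : SimpleGraph (Fin (k + 1)) where
  Adj i j := i ≠ j ∧ (i = 0 ∨ j = 0 ∨ ((i : ℕ) ≤ 4 ↔ (j : ℕ) ≤ 4))
  symm := ⟨fun _ _ h => ⟨h.1.symm, by tauto⟩⟩
  loopless := ⟨fun _ h => h.1 rfl⟩

theorem isQuasiLine_bowtie (k : ℕ) : (bowtie k).IsQuasiLine := by
  refine fun _ => ⟨{i | (i : ℕ) ≤ 4}, {i | i = 0 ∨ ¬ (i : ℕ) ≤ 4}, ?_, ?_, fun i _ => ?_⟩
  · exact fun i hi j hj hij => ⟨hij, Or.inr (Or.inr (iff_of_true hi hj))⟩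
  · rintro i (hi | hi) j (hj | hj) hij
    · exact (hij (hi.trans hj.symm)).elim
    · exact ⟨hij, Or.inl hi⟩
    · exact ⟨hij, Or.inr (Or.inl hj)⟩
    · exact ⟨hij, Or.inr (Or.inr (iff_of_false hi hj))⟩
  · by_cases hi : (i : ℕ) ≤ 4
    · exact Or.inl hi
    · exact Or.inr (Or.inr hi)

theorem card_lt_of_isClique_bowtie {k : ℕ} (hk : 9 ≤ k) {s : Finset (Fin (k + 1))}
    (hs : (bowtie k).IsClique s) : s.card < k := by
  classical
  -- A clique with a vertex beyond `4` misses `1, …, 4`, which leaves at most $k-3$ vertices.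
  by_cases hsub : ∀ i ∈ s, (i : ℕ) ≤ 4
  · have h1 : (s.map Fin.valEmbedding).card ≤ (Finset.range 5).card := by
      refine Finset.card_le_card fun i hi => ?_
      obtain ⟨j, hj, rfl⟩ := Finset.mem_map.1 hi
      have := hsub j hj
      simp only [Fin.valEmbedding_apply, Finset.mem_range]
      omega
    rw [Finset.card_map, Finset.card_range] at h1
    omega
  · push Not at hsub
    obtain ⟨j, hj, hj4⟩ := hsub
    have h1 : (s.map Fin.valEmbedding).card ≤ (Finset.range (k + 1) \ Finset.Icc 1 4).card := by
      refine Finset.card_le_card fun i hi => ?_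
      obtain ⟨i, his, rfl⟩ := Finset.mem_map.1 hi
      simp only [Fin.valEmbedding_apply, Finset.mem_sdiff, Finset.mem_range, Finset.mem_Icc,
        not_and, not_le]
      refine ⟨i.2, fun hi1 => ?_⟩
      by_contra! hi4
      have hij : i ≠ j := by rintro rfl; omega
      rcases (hs his hj hij).2 with h | h | h
      · simp [h] at hi1
      · simp [h] at hj4
      · omega
    rw [Finset.card_map, Finset.card_sdiff_of_subset (fun i hi => by
      simp only [Finset.mem_Icc] at hi
      simp only [Finset.mem_range]
      omega), Finset.card_range, Nat.card_Icc] at h1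
    omega

theorem IsQuasiLine.sum {V W : Type*} {G : SimpleGraph V} {H : SimpleGraph W}
    (hG : G.IsQuasiLine) (hH : H.IsQuasiLine) : (G ⊕g H).IsQuasiLine := by
  rintro (v | v)
  · obtain ⟨A, B, hA, hB, hAB⟩ := hG v
    refine ⟨Sum.inl '' A, Sum.inl '' B, ?_, ?_, ?_⟩
    · rintro _ ⟨x, hx, rfl⟩ _ ⟨y, hy, rfl⟩ hxy
      exact sum_adj_inl.2 (hA hx hy fun h => hxy (congrArg _ h))
    · rintro _ ⟨x, hx, rfl⟩ _ ⟨y, hy, rfl⟩ hxy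
      exact sum_adj_inl.2 (hB hx hy fun h => hxy (congrArg _ h))
    · rintro (x | x) hx
      · exact (hAB ((sum_adj_inl (G := G) (H := H)).1 hx)).imp (fun h => ⟨x, h, rfl⟩) fun h => ⟨x, h, rfl⟩
      · simp at hx
  · obtain ⟨A, B, hA, hB, hAB⟩ := hH v
    refine ⟨Sum.inr '' A, Sum.inr '' B, ?_, ?_, ?_⟩
    · rintro _ ⟨x, hx, rfl⟩ _ ⟨y, hy, rfl⟩ hxy
      exact sum_adj_inr.2 (hA hx hy fun h => hxy (congrArg _ h))
    · rintro _ ⟨x, hx, rfl⟩ _ ⟨y, hy, rfl⟩ hxy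
      exact sum_adj_inr.2 (hB hx hy fun h => hxy (congrArg _ h))
    · rintro (x | x) hx
      · simp at hx
      · exact (hAB ((sum_adj_inr (G := G) (H := H)).1 hx)).imp (fun h => ⟨x, h, rfl⟩) fun h => ⟨x, h, rfl⟩

theorem IsQuasiLine.comap_equiv {V W : Type*} {G : SimpleGraph W} (hG : G.IsQuasiLine)
    (e : V ≃ W) : (G.comap e).IsQuasiLine := by
  intro v
  obtain ⟨A, B, hA, hB, hAB⟩ := hG (e v)
  exact ⟨e ⁻¹' A, e ⁻¹' B, fun x hx y hy hxy => hA hx hy (e.injective.ne hxy),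
    fun x hx y hy hxy => hB hx hy (e.injective.ne hxy), fun x hx => hAB hx⟩

/-- If $j<k$ colors per list sufficed, the uncolorable lists of size $k-1$ could be shrunk to size
$j$ and colored. -/
theorem IsListCritical.le_listChromaticNumber_sum {V W : Type*} [Fintype V] {G : SimpleGraph V}
    [DecidableRel G.Adj] {k : ℕ} {L : V → Finset ℕ} (h : IsListCritical G k L)
    (H : SimpleGraph W) : (k : ℕ∞) ≤ (G ⊕g H).listChromaticNumber := by
  refine le_iInf₂ fun j (hj : (G ⊕g H).Choosable j) => ?_
  by_contra! hlt
  have hjk : j < k := by exact_mod_cast hlt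
  have hsub (x : V) : ∃ S ⊆ L x, S.card = j :=
    Finset.exists_subset_card_eq (by rw [h.card_eq]; omega)
  choose S hSL hS using hsub
  obtain ⟨c, hc⟩ := hj (Sum.elim S fun _ => Finset.range j) (by rintro (x | x) <;> simp [hS])
  exact h.not_good ⟨Coloring.mk (fun x => c (Sum.inl x)) fun hxy => c.valid (sum_adj_inl.2 hxy),
    fun x => hSL x (hc (Sum.inl x))⟩

theorem degree_le_of_injOn {V : Type*} [Fintype V] {G : SimpleGraph V} [DecidableRel G.Adj] {x : V}
    {α : Type*} (f : V → α) {t : Finset α} (hf : ∀ y, G.Adj x y → f y ∈ t)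
    (hinj : ∀ y z, G.Adj x y → G.Adj x z → f y = f z → y = z) : G.degree x ≤ t.card := by
  rw [← card_neighborFinset_eq_degree]
  refine Finset.card_le_card_of_injOn f (fun y hy => hf y (by simpa using hy)) ?_
  intro y hy z hz
  exact hinj y z (by simpa using hy) (by simpa using hz)

theorem maxDegree_sum_bowtie {V : Type*} [Fintype V] {G : SimpleGraph V}
    [DecidableRel G.Adj] {k : ℕ} (hG : ∀ x, G.degree x ≤ k) {U : Type*} [Fintype U]
    (e : U ≃ Fin (k + 1)) [DecidableRel (G ⊕g (bowtie k).comap e).Adj] :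
    (G ⊕g (bowtie k).comap e).maxDegree = k := by
  classical
  refine le_antisymm (maxDegree_le_of_forall_degree_le _ _ ?_) ?_
  · rintro (x | x)
    · refine le_trans ?_ (hG x)
      rw [← card_neighborFinset_eq_degree (G := G), ← Finset.card_map Function.Embedding.inl]
      refine degree_le_of_injOn id (fun y hy => ?_) fun y z _ _ h => h
      rcases y with y | y
      · simpa using hy
      · simp at hy
    · have hcard : (Finset.univ.erase (Sum.inr x : V ⊕ U) ∩
          (Finset.univ.map Function.Embedding.inr)).card ≤ k := by
        have : (Finset.univ.erase (Sum.inr x : V ⊕ U) ∩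
            (Finset.univ.map Function.Embedding.inr)) ⊆
            (Finset.univ.erase x).map Function.Embedding.inr := by
          rintro (y | y) hy
          · simp at hy
          · simpa using hy
        refine (Finset.card_le_card this).trans ?_
        rw [Finset.card_map, Finset.card_erase_of_mem (Finset.mem_univ _), Finset.card_univ,
          Fintype.card_congr e, Fintype.card_fin, Nat.add_sub_cancel]
      refine le_trans (degree_le_of_injOn id (fun y hy => ?_) fun y z _ _ h => h) hcard
      rcases y with y | y
      · simp at hy
      · simpa using hy.ne'
  · refine le_trans ?_ (degree_le_maxDegree _ (Sum.inr (e.symm 0)))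
    have hsub : (Finset.univ.erase (e.symm 0)).map Function.Embedding.inr ⊆
        Finset.univ.filter ((G ⊕g (bowtie k).comap e).Adj (Sum.inr (e.symm 0))) := by
      intro y hy
      obtain ⟨y, hy, rfl⟩ := Finset.mem_map.1 hy
      have hne : y ≠ e.symm 0 := by simpa using hy
      refine Finset.mem_filter.2 ⟨Finset.mem_univ _, sum_adj_inr.2 ?_⟩
      exact ⟨fun h => hne (e.injective h).symm, Or.inl (by simp)⟩
    rw [← card_neighborFinset_eq_degree, neighborFinset_eq_filter]
    refine le_trans ?_ (Finset.card_le_card hsub)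
    rw [Finset.card_map, Finset.card_erase_of_mem (Finset.mem_univ _), Finset.card_univ,
      Fintype.card_congr e, Fintype.card_fin, Nat.add_sub_cancel]

/-- A clique of a disjoint union yields one of the same size in one of the parts. -/
theorem IsNClique.of_sum {V W : Type*} {G : SimpleGraph V} {H : SimpleGraph W} {n : ℕ}
    {s : Finset (V ⊕ W)} (hs : (G ⊕g H).IsNClique n s) :
    (∃ t : Finset V, G.IsNClique n t) ∨ ∃ t : Finset W, H.IsNClique n t := by
  classical
  by_cases hl : ∃ x, Sum.inl x ∈ s
  · obtain ⟨x, hx⟩ := hl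
    have hsl : s.toLeft.map Function.Embedding.inl = s := by
      ext (y | y)
      · simp
      · suffices Sum.inr y ∉ s by simpa
        intro hy
        simpa using hs.isClique hx hy (by simp)
    refine Or.inl ⟨s.toLeft, ⟨fun y hy z hz hyz => ?_, ?_⟩⟩
    · exact sum_adj_inl.1 (hs.isClique (by simpa using hy) (by simpa using hz) (by simpa using hyz))
    · rw [← hs.card_eq, ← hsl, Finset.card_map, hsl]
  · push Not at hl
    have hsr : s.toRight.map Function.Embedding.inr = s := by
      ext (y | y)
      · simpa using hl y
      · simp
    refine Or.inr ⟨s.toRight, ⟨fun y hy z hz hyz => ?_, ?_⟩⟩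
    · exact sum_adj_inr.1 (hs.isClique (by simpa using hy) (by simpa using hz) (by simpa using hyz))
    · rw [← hs.card_eq, ← hsr, Finset.card_map, hsr]

/-- The vertex shared by the two cliques of the bowtie has degree $k$. This raises the maximum
degree of the union to exactly $k$ without adding a $k$-clique. -/
theorem IsListCritical.exists_isNClique
    (hQuasiLine : ∀ (V : Type u) [Fintype V] (G : SimpleGraph V) [DecidableRel G.Adj],
      G.IsQuasiLine → 9 ≤ G.maxDegree → (G.maxDegree : ℕ∞) ≤ G.listChromaticNumber →
        ∃ s : Finset V, G.IsNClique G.maxDegree s)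
    {W : Type u} [Fintype W] {H : SimpleGraph W} [DecidableRel H.Adj] {k : ℕ} {L : W → Finset ℕ}
    (h : IsListCritical H k L) (hk : 9 ≤ k) (hq : H.IsQuasiLine) :
    ∃ s : Finset W, H.IsNClique k s := by
  classical
  -- The assumption concerns graphs in universe `u` only, so the bowtie is lifted there.
  let e : ULift.{u} (Fin (k + 1)) ≃ Fin (k + 1) := Equiv.ulift
  have hmax : (H ⊕g (bowtie k).comap e).maxDegree = k := maxDegree_sum_bowtie h.degree_le e
  obtain ⟨s, hs⟩ := hQuasiLine _ (H ⊕g (bowtie k).comap e)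
    (hq.sum ((isQuasiLine_bowtie k).comap_equiv e)) (by rwa [hmax])
    (by rw [hmax]; exact h.le_listChromaticNumber_sum _)
  rw [hmax] at hs
  rcases hs.of_sum with ht | ⟨t, ht⟩
  · exact ht
  · have hclique : (bowtie k).IsClique (t.map e.toEmbedding : Finset (Fin (k + 1))) := by
      intro x hx y hy hxy
      obtain ⟨x, hx', rfl⟩ := Finset.mem_map.1 (Finset.mem_coe.1 hx)
      obtain ⟨y, hy', rfl⟩ := Finset.mem_map.1 (Finset.mem_coe.1 hy)
      exact ht.isClique hx' hy' fun h => hxy (congrArg _ h)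
    have := card_lt_of_isClique_bowtie hk hclique
    rw [Finset.card_map, ht.card_eq] at this
    omega

theorem IsClawFree.induce {V : Type*} {G : SimpleGraph V} (h : G.IsClawFree) (s : Set V) :
    (G.induce s).IsClawFree :=
  fun ⟨f⟩ => h ⟨f.trans (Embedding.induce s)⟩

/-- The bad lists stay fixed while the vertex set shrinks to a minimal one that cannot be colored
from them. -/
theorem exists_isListCritical_induce {V : Type*} [Fintype V] {G : SimpleGraph V}
    [DecidableRel G.Adj] {k : ℕ} (hdeg : ∀ x, G.degree x ≤ k) (hG : ¬ G.Choosable (k - 1)) :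
    ∃ (S : Finset V) (L : ↥(S : Set V) → Finset ℕ),
      IsListCritical (G.induce (S : Set V)) k L := by
  classical
  simp only [Choosable, FChoosable, not_forall] at hG
  obtain ⟨L, hL, hbad⟩ := hG
  let Q (S : Finset V) : Prop := ∃ c : V → ℕ, (∀ x ∈ S, c x ∈ L x) ∧
    ∀ x ∈ S, ∀ y ∈ S, G.Adj x y → c x ≠ c y
  have huniv : ¬ Q Finset.univ := by
    rintro ⟨c, hc, hc'⟩
    exact hbad ⟨Coloring.mk c fun hxy => hc' _ (by simp) _ (by simp) hxy, fun x => hc x (by simp)⟩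
  obtain ⟨S, hS, hmin⟩ := WellFounded.has_min
    (r := fun S T : Finset V => S ⊂ T) Finset.isWellFounded_ssubset.wf {S | ¬ Q S} ⟨_, huniv⟩
  refine ⟨S, fun x => L x, fun x => ?_, fun x => hL x, ?_, fun T hT => ?_⟩
  · refine le_trans ?_ (hdeg x)
    rw [← card_neighborFinset_eq_degree (G := G)]
    exact degree_le_of_injOn Subtype.val (fun y hy => by simpa using hy)
      fun y z _ _ h => Subtype.ext h
  · rintro ⟨c, hc⟩
    refine hS ⟨fun x => if hx : x ∈ S then c ⟨x, hx⟩ else 0, fun x hx => ?_,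
      fun x hx y hy hxy => ?_⟩
    · simpa [hx] using hc ⟨x, hx⟩
    · simp only [hx, hy, dif_pos]
      exact c.valid (show (G.induce (S : Set V)).Adj ⟨x, hx⟩ ⟨y, hy⟩ from hxy)
  · have hlt : S \ T.map (Function.Embedding.subtype _) ⊂ S := by
      obtain ⟨x, hx⟩ := hT
      refine (Finset.ssubset_iff_of_subset Finset.sdiff_subset).2 ⟨x, x.2, ?_⟩
      simp [hx]
    obtain ⟨c, hc, hc'⟩ := not_not.1 fun h => hmin _ h hlt
    have hmem (x : ↥(S : Set V)) (hx : x ∉ T) :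
        (x : V) ∈ S \ T.map (Function.Embedding.subtype _) := by
      have := x.2
      simp_all
    exact ⟨fun x => c x, fun x hx => hc x (hmem x hx),
      fun x hx y hy hxy => hc' x (hmem x hx) y (hmem y hy) hxy⟩

end Reduction

end SimpleGraph

theorem mainTheorem3
    (hQuasiLine : ∀ (V : Type u) [Fintype V] (G : SimpleGraph V) [DecidableRel G.Adj],
      G.IsQuasiLine → 9 ≤ G.maxDegree → (G.maxDegree : ℕ∞) ≤ G.listChromaticNumber →
        ∃ s : Finset V, G.IsNClique G.maxDegree s)
    (V : Type u) [Fintype V] (G : SimpleGraph V) [DecidableRel G.Adj]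
    (hClawFree : G.IsClawFree) (hDelta : 9 ≤ G.maxDegree)
    (hChi : (G.maxDegree : ℕ∞) ≤ G.listChromaticNumber) :
    ∃ s : Finset V, G.IsNClique G.maxDegree s := by
  classical
  have hG : ¬ G.Choosable (G.maxDegree - 1) := by
    intro h
    have h1 : G.listChromaticNumber ≤ ((G.maxDegree - 1 : ℕ) : ℕ∞) := iInf₂_le _ h
    have h2 : G.maxDegree ≤ G.maxDegree - 1 := by exact_mod_cast hChi.trans h1
    omega
  obtain ⟨S, L, h⟩ := SimpleGraph.exists_isListCritical_induce (fun x => G.degree_le_maxDegree x) hG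
  obtain ⟨s, hs⟩ := h.exists_isNClique hQuasiLine hDelta
    (h.isQuasiLine hDelta (hClawFree.induce _))
  exact ⟨s.map (Function.Embedding.subtype _), hs.map.mono (SimpleGraph.map_comap_le _ _)⟩
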